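/- Let $\alpha\in[0,1]$, $m\ge 1$, $\mathcal{H}_0\subseteq[m]=\{1,\dots,m\}$ and $\epsilon,\delta\ge 0$. Let $p_1,\dots,p_m$ be $[0,1]$-valued random variables on a probability space that are $(\epsilon,\delta)$-approximate compound p-values, i.e. \[\sum_{i\in\mathcal{H}_0}\mathbb{P}(p_i\le t)\le m\big(t(1+\epsilon)+\delta\big)\quad\text{for all } t\in[0,1].\] Suppose that $p_1,\dots,p_m$ are independent or, more generally, that $(p_i)_{i\in\mathcal{H}_0}$ are mutually independent and the vector $(p_i)_{i\in\mathcal{H}_0}$ is independent of the vector $(p_i)_{i\notin\mathcal{H}_0}$. Let \[\widehat{k}=\max\Big\{k\in[m]:\ \#\{i\in[m]: p_i\le \tfrac{\alpha k}{m}\}\ge k\Big\}\] (with $\widehat{k}=0$ if this set is empty), and let $\widehat{S}=\{i\in[m]: p_i\le \alpha\widehat{k}/m\}$ be the rejection set of the Benjamini--Hochberg procedure at level $\alpha$. If $\delta=0$, then the false discovery rate of the procedure satisfies \[\mathsf{FDR}:=\mathbb{E}\left[\frac{|\widehat{S}\cap\mathcal{H}_0|}{\max\{1,|\widehat{S}|\}}\right]\le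 1.93\,\alpha(1+\epsilon).\] If $\delta>0$, then \[\mathbb{E}\left[\frac{|\widehat{S}\cap\mathcal{H}_0|}{\frac{m\delta}{\alpha(1+\epsilon)}+|\widehat{S}|}\right]\le 1.93\,\alpha(1+\epsilon),\] where for $\alpha=0$ the denominator is read as $+\infty$ and the ratio as $0$. -/

import Mathlib

open MeasureTheory ProbabilityTheory

noncomputable section

/-- The number of rejections of the Benjamini-Hochberg procedure at level `α`: the largest
`k ∈ {1, …, m}` such that at least `k` of the values `p i` are at most `α k / m`,
and `0` if there is no such `k`. -/
def bhNumRejections {m : ℕ} (α : ℝ) (p : Fin m → ℝ) : ℕ :=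
  ((Finset.Icc 1 m).filter fun k : ℕ =>
    k ≤ (Finset.univ.filter fun i : Fin m => p i ≤ α * (k : ℝ) / (m : ℝ)).card).sup id

/-- The rejection set of the Benjamini-Hochberg procedure at level `α`. -/
def bhRejections {m : ℕ} (α : ℝ) (p : Fin m → ℝ) : Finset (Fin m) :=
  Finset.univ.filter fun i : Fin m => p i ≤ α * (bhNumRejections α p : ℝ) / (m : ℝ)

/-- The false discovery proportion of a set `S` of discoveries, where `H₀` is the set of
(indices of) true nulls. -/
def FDP {m : ℕ} (H₀ S : Finset (Fin m)) : ℝ :=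
  ((S ∩ H₀).card : ℝ) / max 1 (S.card : ℝ)

/-- The false discovery rate of the Benjamini-Hochberg procedure at level `α`: the expected
false discovery proportion. -/
def bhFDR {Ω : Type*} [MeasurableSpace Ω] (μ : Measure Ω) {m : ℕ} (H₀ : Finset (Fin m))
    (α : ℝ) (p : Fin m → Ω → ℝ) : ℝ :=
  ∫ ω, FDP H₀ (bhRejections α fun i => p i ω) ∂μ

/-- The modified false discovery proportion `|S ∩ H₀| / (m δ / (α (1 + ε)) + |S|)`, for `δ > 0`.
If `α = 0`, the first term of the denominator is `+∞`, so that the ratio is `0`. -/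
def modifiedFDP {m : ℕ} (ε δ α : ℝ) (H₀ S : Finset (Fin m)) : ℝ :=
  if α = 0 then 0
  else ((S ∩ H₀).card : ℝ) / ((m : ℝ) * δ / (α * (1 + ε)) + (S.card : ℝ))

/-- `p 1, …, p m` are `(ε, δ)`-approximate compound p-values for the set `H₀` of true nulls. -/
def IsApproxCompoundPValues {Ω : Type*} [MeasurableSpace Ω] (μ : Measure Ω) {m : ℕ}
    (H₀ : Finset (Fin m)) (ε δ : ℝ) (p : Fin m → Ω → ℝ) : Prop :=
  ∀ t ∈ Set.Icc (0 : ℝ) 1,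
    ∑ i ∈ H₀, μ.real {ω | p i ω ≤ t} ≤ (m : ℝ) * (t * (1 + ε) + δ)

/-- The independence assumption: the null values `(p i)_{i ∈ H₀}` are mutually independent, and
they are jointly independent of the non-null values `(p i)_{i ∉ H₀}`.  This follows from mutual
independence of all the `p i`, see `nullIndep_of_iIndepFun`. -/
def NullIndep {Ω : Type*} [MeasurableSpace Ω] (μ : Measure Ω) {m : ℕ}
    (H₀ : Finset (Fin m)) (p : Fin m → Ω → ℝ) : Prop :=
  iIndepFun (fun (i : {i // i ∈ H₀}) => p i) μ ∧
    IndepFun (fun ω (i : {i // i ∈ H₀}) => p i ω) (fun ω (i : {i // i ∉ H₀}) => p i ω) μ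

theorem nullIndep_of_iIndepFun {Ω : Type*} [MeasurableSpace Ω] {μ : Measure Ω} {m : ℕ}
    (H₀ : Finset (Fin m)) {p : Fin m → Ω → ℝ} (hmeas : ∀ i, Measurable (p i))
    (h : iIndepFun p μ) : NullIndep μ H₀ p := by
  refine ⟨h.precomp Subtype.val_injective, ?_⟩
  have h1 := h.indepFun_finset H₀ H₀ᶜ disjoint_compl_right hmeas
  exact h1.comp (φ := id)
    (ψ := fun (x : {i // i ∈ H₀ᶜ} → ℝ) (i : {i // i ∉ H₀}) => x ⟨i, Finset.mem_compl.2 i.2⟩)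
    measurable_id (measurable_pi_lambda _ fun _ => measurable_pi_apply _)

end

/-!
Write `A = α (1 + ε)` and `κ = m δ / A`, so that the assumption bounds the expected number of nulls
below the grid point `α k / m` by `A (k + κ)`.  The procedure sees a p-value only through its level,
i.e. its position relative to the grid points (`pLevel`), so all variables become finite-valued.

*Reduction to the nulls.*  Fix the levels of the non-nulls, which is allowed by independence
(`integral_le_of_indepFun`).  If `j` nulls are rejected, the total number of rejections is
`r j = max {k ≤ m : k ≤ j + #(non-nulls at level ≤ k)}`, a deterministic function, and the number
`V` of false rejections is the largest `j` such that at least `j` nulls have level at most `r j`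
(`findGreatest_add_eq`, `card_levelRejections`).  Call this a success at `j`.  The ratio to be
averaged is `A * (V / x V)` with `x j = A (r j + κ)`, an upper bound for the expected number of
nulls of level at most `r j`.  It remains to show `E (V / x V) ≤ 1.93` for every sequence `x`.

*Induction over the stages.*  Let `w k` bound the expectation of `V / x V` over `V ≤ k`, relative to
`P (V ≤ k)`.  Passing from `k` to `k + 1` the new event is `V = k + 1`: a success at `k + 1` and
none later.  A success is decreasing and the absence of later successes is increasing in the levels,
so Harris' inequality gives `P (V = k + 1) ≤ P (success at k + 1) * P (V ≤ k + 1)`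
(`measureReal_stepUp_eq_le`).  By Markov's inequality the first factor is at most the stop-loss
expectation `E (N - k)⁺` of a sum `N` of independent Bernoulli variables, which is dominated by
the stop-loss function `poissonExcess k` of a Poisson variable of mean `x (k + 1)`
(`integral_max_sum_sub_le`).  Hence `w (k + 1) = w k + d k` is admissible as soon as
`((k + 1) / x - w k) * poissonExcess k x ≤ d k` for all `x > 0` (`integral_stepUp_div_le`).

*Numerics.*  `budgetStep` is such a sequence `d` (`mul_poissonExcess_le_budgetStep`), and its sum is
at most `1.93` (`budget_le`).  To verify it, the power series of the stop-loss function is compared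
with a negative binomial series (`poissonExcess_le`).  The resulting closed form has a logarithm
that can be bounded by its tangent at a rational point near the maximiser, which reduces the
first stages to rational arithmetic (`mul_poissonExcess_le_of_rat`); the stages from `15` on decay
geometrically (`decay_le`).
-/

/-! ### The Poisson stop-loss function -/

/-- The stop-loss function `E (Z - s)⁺` of a Poisson variable `Z` with mean `x`, in closed form. -/
noncomputable def poissonExcess (s : ℕ) (x : ℝ) : ℝ :=
  x - s + Real.exp (-x) * ∑ j ∈ Finset.range s, ((s : ℝ) - j) * (x ^ j / j.factorial)

/-- The upper tail `P (Z ≥ s)` of a Poisson variable `Z` with mean `x`. -/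
noncomputable def poissonTail (s : ℕ) (x : ℝ) : ℝ :=
  1 - Real.exp (-x) * ∑ j ∈ Finset.range s, x ^ j / j.factorial

lemma poissonExcess_zero (x : ℝ) : poissonExcess 0 x = x := by simp [poissonExcess]

lemma poissonExcess_sub_succ (s : ℕ) (x : ℝ) :
    poissonExcess s x - poissonExcess (s + 1) x = poissonTail (s + 1) x := by
  have h : ∑ j ∈ Finset.range (s + 1), (((s + 1 : ℕ) : ℝ) - j) * (x ^ j / j.factorial)
      = ∑ j ∈ Finset.range s, ((s : ℝ) - j) * (x ^ j / j.factorial)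
        + ∑ j ∈ Finset.range (s + 1), x ^ j / j.factorial := by
    have h0 : ∑ j ∈ Finset.range s, ((s : ℝ) - j) * (x ^ j / j.factorial)
        = ∑ j ∈ Finset.range (s + 1), ((s : ℝ) - j) * (x ^ j / j.factorial) := by
      rw [Finset.sum_range_succ]; simp
    rw [h0, ← Finset.sum_add_distrib]
    refine Finset.sum_congr rfl fun j _ => ?_
    push_cast; ring
  simp only [poissonExcess, poissonTail, h]
  push_cast; ring

lemma hasDerivAt_sum_pow_div_factorial (s : ℕ) (x : ℝ) :
    HasDerivAt (fun y : ℝ => ∑ j ∈ Finset.range (s + 1), y ^ j / (j.factorial : ℝ))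
      (∑ j ∈ Finset.range s, x ^ j / (j.factorial : ℝ)) x := by
  induction s with
  | zero => simpa using hasDerivAt_const x (1 : ℝ)
  | succ s ih =>
    have h1 : HasDerivAt (fun y : ℝ => y ^ (s + 1) / ((s + 1).factorial : ℝ))
        (x ^ s / (s.factorial : ℝ)) x := by
      have h2 := (hasDerivAt_pow (s + 1) x).div_const ((s + 1).factorial : ℝ)
      refine h2.congr_deriv ?_
      rw [Nat.factorial_succ]
      push_cast
      have : (s.factorial : ℝ) ≠ 0 := by positivity
      have : (s : ℝ) + 1 ≠ 0 := by positivity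
      field_simp
    have h3 := ih.add h1
    simp only [Finset.sum_range_succ _ (s + 1)]
    rw [Finset.sum_range_succ]
    exact h3

lemma hasDerivAt_poissonTail_succ (s : ℕ) (x : ℝ) :
    HasDerivAt (poissonTail (s + 1)) (Real.exp (-x) * (x ^ s / s.factorial)) x := by
  have h := (((hasDerivAt_neg x).exp).mul (hasDerivAt_sum_pow_div_factorial s x)).const_sub 1
  refine h.congr_deriv ?_
  rw [Finset.sum_range_succ]
  ring

lemma hasDerivAt_poissonExcess (s : ℕ) (x : ℝ) :
    HasDerivAt (poissonExcess s) (poissonTail s x) x := by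
  induction s with
  | zero =>
    have : poissonExcess 0 = fun x => x := by ext x; exact poissonExcess_zero x
    rw [this]
    simpa [poissonTail] using hasDerivAt_id' x
  | succ s ih =>
    have h1 : poissonExcess (s + 1) = fun y => poissonExcess s y - poissonTail (s + 1) y := by
      ext y; rw [← poissonExcess_sub_succ]; ring
    rw [h1]
    refine (ih.sub (hasDerivAt_poissonTail_succ s x)).congr_deriv ?_
    simp only [poissonTail, Finset.sum_range_succ _ s]
    ring

lemma poissonTail_mono (s : ℕ) {x y : ℝ} (hx : 0 ≤ x) (hxy : x ≤ y) :
    poissonTail s x ≤ poissonTail s y := by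
  rcases s with _ | s
  · simp [poissonTail]
  · have hd := hasDerivAt_poissonTail_succ s
    refine monotoneOn_of_deriv_nonneg (convex_Ici 0)
      (fun z _ => (hd z).continuousAt.continuousWithinAt)
      (fun z _ => (hd z).differentiableAt.differentiableWithinAt) (fun z hz => ?_)
      (Set.mem_Ici.2 hx) (Set.mem_Ici.2 (hx.trans hxy)) hxy
    rw [interior_Ici] at hz
    have hz0 : 0 < z := hz
    rw [(hd z).deriv]
    positivity

lemma poissonTail_nonneg (s : ℕ) {x : ℝ} (hx : 0 ≤ x) : 0 ≤ poissonTail s x := by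
  refine le_trans ?_ (poissonTail_mono s le_rfl hx)
  rcases s with _ | s
  · simp [poissonTail]
  · simp [poissonTail, Finset.sum_range_succ']

/-- Convexity of `poissonExcess s` on `[0, ∞)`, in the form of a tangent line bound. -/
lemma poissonExcess_add_le (s : ℕ) {x w : ℝ} (hx : 0 ≤ x) (hw : 0 ≤ w) :
    poissonExcess s x + w * poissonTail s x ≤ poissonExcess s (x + w) := by
  have hd := hasDerivAt_poissonExcess s
  have h := (convex_Ici x).mul_sub_le_image_sub_of_le_deriv
    (fun z _ => (hd z).continuousAt.continuousWithinAt)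
    (fun z _ => (hd z).differentiableAt.differentiableWithinAt)
    (C := poissonTail s x) (fun z hz => ?_) x Set.self_mem_Ici (x + w)
    (Set.mem_Ici.2 (by linarith)) (by linarith)
  · linarith
  · rw [interior_Ici] at hz
    rw [(hd z).deriv]
    exact poissonTail_mono s hx (le_of_lt hz)

lemma poissonExcess_mono (s : ℕ) {x y : ℝ} (hx : 0 ≤ x) (hxy : x ≤ y) :
    poissonExcess s x ≤ poissonExcess s y := by
  have h := poissonExcess_add_le s hx (sub_nonneg.2 hxy)
  have h2 := mul_nonneg (sub_nonneg.2 hxy) (poissonTail_nonneg s hx)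
  rw [add_sub_cancel] at h
  linarith

lemma poissonExcess_zero_right (s : ℕ) : poissonExcess s 0 = 0 := by
  rcases s with _ | s
  · simp [poissonExcess]
  · simp [poissonExcess, Finset.sum_range_succ']

lemma poissonExcess_nonneg (s : ℕ) {x : ℝ} (hx : 0 ≤ x) : 0 ≤ poissonExcess s x := by
  have := poissonExcess_mono s le_rfl hx
  rwa [poissonExcess_zero_right] at this

/-- The inductive step in comparing a sum of independent Bernoulli variables with a Poisson
variable: a Bernoulli summand of mean `w` may be replaced by a Poisson one. -/
lemma bernoulli_step_le (s : ℕ) {x w : ℝ} (hx : 0 ≤ x) (hw : 0 ≤ w) :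
    (1 - w) * poissonExcess (s + 1) x + w * poissonExcess s x ≤ poissonExcess (s + 1) (x + w) := by
  have h := poissonExcess_add_le (s + 1) hx hw
  rw [← poissonExcess_sub_succ] at h
  linarith

/-- The power series of the Poisson stop-loss function. -/
lemma hasSum_poissonExcess (s : ℕ) (x : ℝ) :
    HasSum (fun j : ℕ => ((j : ℝ) + 1) * (x ^ (s + 1 + j) / (s + 1 + j).factorial))
      (Real.exp x * poissonExcess s x) := by
  have hexp : HasSum (fun n : ℕ => x ^ n / (n.factorial : ℝ)) (Real.exp x) := by
    have := NormedSpace.expSeries_div_hasSum_exp (𝔸 := ℝ) x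
    rwa [← Real.exp_eq_exp_ℝ] at this
  have h1 : HasSum (fun n : ℕ => (n : ℝ) * (x ^ n / (n.factorial : ℝ))) (x * Real.exp x) := by
    rw [← hasSum_nat_add_iff' 1]
    simp only [Finset.range_one, Finset.sum_singleton, Nat.cast_zero, zero_mul, sub_zero]
    refine (hexp.mul_left x).congr_fun fun n => ?_
    rw [Nat.factorial_succ]
    push_cast
    have : (n.factorial : ℝ) ≠ 0 := by positivity
    have : (n : ℝ) + 1 ≠ 0 := by positivity
    field_simp
    ring
  have h2 : HasSum (fun n : ℕ => ((n : ℝ) - s) * (x ^ n / (n.factorial : ℝ)))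
      (x * Real.exp x - s * Real.exp x) := by
    refine (h1.sub (hexp.mul_left (s : ℝ))).congr_fun fun n => ?_
    ring
  have h3 := (hasSum_nat_add_iff' (s + 1)).2 h2
  have h4 : x * Real.exp x - s * Real.exp x
      - ∑ j ∈ Finset.range (s + 1), ((j : ℝ) - s) * (x ^ j / j.factorial)
      = Real.exp x * poissonExcess s x := by
    have h0 : Real.exp x * Real.exp (-x) = 1 := by rw [← Real.exp_add]; simp
    rw [Finset.sum_range_succ, poissonExcess]
    have : ∑ j ∈ Finset.range s, ((s : ℝ) - j) * (x ^ j / j.factorial)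
        = - ∑ j ∈ Finset.range s, ((j : ℝ) - s) * (x ^ j / j.factorial) := by
      rw [← Finset.sum_neg_distrib]
      exact Finset.sum_congr rfl fun j _ => by ring
    rw [this]
    linear_combination (∑ j ∈ Finset.range s, ((j : ℝ) - s) * (x ^ j / j.factorial)) * h0
  rw [← h4]
  refine h3.congr_fun fun j => ?_
  rw [Nat.add_comm (s + 1) j]
  push_cast
  ring

/-! ### A closed-form bound for the stop-loss function -/

/-- Term-by-term comparison of the power series of the Poisson stop-loss function with a negative
binomial series.  The first two coefficients agree, and the condition on `ν` makes the ratios of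
consecutive coefficients of the latter larger. -/
lemma coeff_le_choose (k ν : ℕ) (hk : 1 ≤ k) (hν1 : 1 ≤ ν) (hν : ν * (k - 1) ≤ 2 * (k + 2)) (j : ℕ) :
    ((j : ℝ) + 1) / (k + j).factorial
      ≤ 1 / k.factorial * ((j + (ν - 1)).choose (ν - 1) * (2 / (ν * (k + 1))) ^ j) := by
  obtain ⟨n, rfl⟩ : ∃ n, ν = n + 1 := ⟨ν - 1, by omega⟩
  obtain ⟨l, rfl⟩ : ∃ l, k = l + 1 := ⟨k - 1, by omega⟩
  simp only [Nat.add_sub_cancel] at hν ⊢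
  induction j with
  | zero => simp
  | succ j ih =>
    have hc : (((j + 1 + n).choose n : ℕ) : ℝ) * (j + 1) = (j + n + 1) * ((j + n).choose n : ℕ) := by
      have h := Nat.add_one_mul_choose_eq (j + n) j
      have e1 : (j + n).choose j = (j + n).choose n := Nat.choose_symm_add
      have e2 : (j + n + 1).choose (j + 1) = (j + 1 + n).choose n := by
        rw [show j + n + 1 = (j + 1) + n by ring]; exact Nat.choose_symm_add
      rw [e1, e2] at h
      exact_mod_cast h.symm
    have hν' : ((n : ℝ) + 1) * l ≤ 2 * (l + 3) := by exact_mod_cast hν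
    set C : ℝ := (((j + n).choose n : ℕ) : ℝ) with hC
    set D : ℝ := (((j + 1 + n).choose n : ℕ) : ℝ) with hD
    have hCD : D = (j + n + 1) / (j + 1) * C := by
      field_simp
      linarith
    have hf : (((l + 1 + (j + 1)).factorial : ℕ) : ℝ) = (l + j + 2) * (l + 1 + j).factorial := by
      rw [show l + 1 + (j + 1) = (l + 1 + j) + 1 by ring, Nat.factorial_succ]
      push_cast; ring
    rw [hf, hCD, pow_succ]
    push_cast at ih ⊢
    have hratio : ((j : ℝ) + 2) / ((j + 1) * (l + j + 2))
        ≤ (j + n + 1) / (j + 1) * (2 / ((n + 1) * (l + 1 + 1))) := by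
      rw [div_mul_div_comm, div_le_div_iff₀ (by positivity) (by positivity)]
      have hj : (0 : ℝ) ≤ j := j.cast_nonneg
      have hn : (0 : ℝ) ≤ n := n.cast_nonneg
      have hl : (0 : ℝ) ≤ l := l.cast_nonneg
      have key : ((j : ℝ) + 2) * ((n + 1) * (l + 2)) ≤ (j + n + 1) * 2 * (l + j + 2) := by
        have hjj : (j : ℝ) ≤ j * j := by exact_mod_cast Nat.le_mul_self j
        nlinarith [mul_le_mul_of_nonneg_left hν' hj]
      nlinarith [mul_le_mul_of_nonneg_left key (by positivity : (0 : ℝ) ≤ j + 1)]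
    calc ((j : ℝ) + 1 + 1) / ((l + j + 2) * (l + 1 + j).factorial)
        = ((j + 2) / ((j + 1) * (l + j + 2))) * ((j + 1) / (l + 1 + j).factorial) := by
          field_simp; ring
      _ ≤ ((j + n + 1) / (j + 1) * (2 / ((n + 1) * (l + 1 + 1))))
          * (1 / (l + 1).factorial * (C * (2 / ((n + 1) * (l + 1 + 1))) ^ j)) := by
          gcongr
      _ = _ := by ring

/-- Closed-form bound for the Poisson stop-loss function at `k - 1`. -/
lemma poissonExcess_le (k ν : ℕ) (hk : 1 ≤ k) (hν1 : 1 ≤ ν) (hν : ν * (k - 1) ≤ 2 * (k + 2))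
    {x : ℝ} (hx : 0 ≤ x) (hxm : 2 * x < ν * (k + 1)) :
    poissonExcess (k - 1) x
      ≤ Real.exp (-x) * x ^ k / k.factorial * (1 / (1 - 2 * x / (ν * (k + 1))) ^ ν) := by
  have hm : (0 : ℝ) < ν * (k + 1) := by positivity
  have hr : ‖2 * x / (ν * (k + 1) : ℝ)‖ < 1 := by
    rw [Real.norm_of_nonneg (by positivity), div_lt_one hm]; exact hxm
  have h1 := hasSum_poissonExcess (k - 1) x
  have h2 := (hasSum_choose_mul_geometric_of_norm_lt_one (ν - 1) hr).mul_left (x ^ k / k.factorial)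
  have h3 := hasSum_le (fun j => ?_) h1 h2
  · have h0 : Real.exp (-x) * Real.exp x = 1 := by rw [← Real.exp_add]; simp
    rw [Nat.sub_add_cancel hν1] at h3
    calc poissonExcess (k - 1) x = Real.exp (-x) * (Real.exp x * poissonExcess (k - 1) x) := by
          rw [← mul_assoc, h0, one_mul]
      _ ≤ Real.exp (-x) * (x ^ k / k.factorial * (1 / (1 - 2 * x / (ν * (k + 1))) ^ ν)) := by
          gcongr
      _ = _ := by ring
  · rw [Nat.sub_add_cancel hk]
    have h := mul_le_mul_of_nonneg_left (coeff_le_choose k ν hk hν1 hν j)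
      (pow_nonneg hx (k + j))
    calc ((j : ℝ) + 1) * (x ^ (k + j) / (k + j).factorial)
        = x ^ (k + j) * (((j : ℝ) + 1) / (k + j).factorial) := by ring
      _ ≤ _ := h
      _ = _ := by rw [pow_add, div_pow, div_pow, mul_pow]; ring

/-- Log-tangent bound for `h ↦ (1 - a h) / (1 - b h) ^ ν` at `h = 0`. -/
lemma one_sub_div_pow_le_exp {a b h : ℝ} (ν : ℕ) (hν : 1 ≤ ν) (hb : 0 ≤ b) (hab : ν * b ≤ a)
    (h1 : 0 < 1 - b * h) :
    (1 - a * h) / (1 - b * h) ^ ν ≤ Real.exp ((ν * b - a) * h) := by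
  obtain ⟨n, rfl⟩ : ∃ n, ν = n + 1 := ⟨ν - 1, by omega⟩
  push_cast at hab ⊢
  have e1 : (1 - a * h) / (1 - b * h) ≤ Real.exp (-(a - b) * (h / (1 - b * h))) := by
    have := Real.add_one_le_exp (-(a - b) * (h / (1 - b * h)))
    refine le_trans (le_of_eq ?_) this
    rw [div_eq_iff h1.ne']
    linear_combination (a - b) * div_mul_cancel₀ h h1.ne'
  have e2 : 1 / (1 - b * h) ≤ Real.exp (b * (h / (1 - b * h))) := by
    have := Real.add_one_le_exp (b * (h / (1 - b * h)))
    refine le_trans (le_of_eq ?_) this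
    rw [div_eq_iff h1.ne']
    linear_combination (-b) * div_mul_cancel₀ h h1.ne'
  calc (1 - a * h) / (1 - b * h) ^ (n + 1)
      = (1 - a * h) / (1 - b * h) * (1 / (1 - b * h)) ^ n := by
        rw [pow_succ, one_div, inv_pow]; field_simp
    _ ≤ Real.exp (-(a - b) * (h / (1 - b * h))) * Real.exp (b * (h / (1 - b * h))) ^ n := by
        gcongr
    _ = Real.exp (((n + 1) * b - a) * (h / (1 - b * h))) := by
        rw [← Real.exp_nat_mul, ← Real.exp_add]; ring_nf
    _ ≤ Real.exp (((n + 1) * b - a) * h) := by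
        apply Real.exp_le_exp.2
        apply mul_le_mul_of_nonpos_left _ (by linarith)
        rw [le_div_iff₀ h1]
        nlinarith [mul_nonneg hb (mul_self_nonneg h)]

/-! ### Maximising the gain of a single stage -/

/-- The maximum of `x ↦ (k / x - w) * poissonExcess (k - 1) x` is bounded through the tangent at
`θ` to the logarithm of the bound of `poissonExcess_le`.  The hypothesis on `w` says that `θ` is a
critical point for some `w' ≤ w`. -/
lemma mul_poissonExcess_le_tangent (k ν : ℕ) {θ w a : ℝ} (hk : 1 ≤ k) (hν2 : 2 ≤ ν)
    (hν : ν * (k - 1) ≤ 2 * (k + 2)) (hθ : 0 < θ) (hθk : θ ≤ (k : ℝ) - 1) (hw1 : 1 ≤ w)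
    (ha : a = ((k : ℝ) - 1) / θ - 1 + ν * (2 / (ν * (k + 1) - 2 * θ)))
    (hw : k * a ≤ w * (1 + a * θ)) {x : ℝ} (hx : 0 < x) :
    ((k : ℝ) / x - w) * poissonExcess (k - 1) x
      ≤ k / (θ * (1 + a * θ)) * (θ ^ k * Real.exp (-θ) / k.factorial)
        * (1 / (1 - 2 * θ / (ν * (k + 1))) ^ ν) := by
  have hk1 : (1 : ℝ) ≤ k := by exact_mod_cast hk
  have hν2' : (2 : ℝ) ≤ ν := by exact_mod_cast hν2
  have hm0 : (0 : ℝ) < ν * (k + 1) := by positivity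
  have hmk : 2 * ((k : ℝ) + 1) ≤ ν * (k + 1) := by gcongr
  have hmθ : 0 < ν * ((k : ℝ) + 1) - 2 * θ := by linarith
  set b : ℝ := 2 / (ν * (k + 1) - 2 * θ) with hb
  have hb0 : 0 < b := by positivity
  have hab : ν * b ≤ a := by
    have : 1 ≤ ((k : ℝ) - 1) / θ := by rw [le_div_iff₀ hθ]; linarith
    linarith
  have ha0 : 0 < a := lt_of_lt_of_le (by positivity) hab
  have haθ : 0 < 1 + a * θ := by positivity
  have hd0 : 0 < 1 - 2 * θ / (ν * ((k : ℝ) + 1)) := by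
    rw [sub_pos, div_lt_one hm0]; linarith
  have hψ := poissonExcess_nonneg (k - 1) hx.le
  rcases le_or_gt ((k : ℝ) / x - w) 0 with hneg | hpos
  · exact (mul_nonpos_of_nonpos_of_nonneg hneg hψ).trans (by positivity)
  have hxk : x < k := by
    have h1 : 1 < (k : ℝ) / x := by linarith
    rwa [lt_div_iff₀ hx, one_mul] at h1
  have h1x : 0 < ν * ((k : ℝ) + 1) - 2 * x := by linarith
  have h1b : 1 - b * (x - θ) = (ν * (k + 1) - 2 * x) / (ν * (k + 1) - 2 * θ) := by
    rw [hb]; field_simp; ring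
  have h1b0 : 0 < 1 - b * (x - θ) := by rw [h1b]; positivity
  have hd : 1 - 2 * x / (ν * ((k : ℝ) + 1))
      = (1 - 2 * θ / (ν * (k + 1))) * (1 - b * (x - θ)) := by
    rw [h1b]; field_simp
  have hkw : (k : ℝ) / x - w ≤ k / (1 + a * θ) * (1 - a * (x - θ)) / x := by
    have : (k : ℝ) * a / (1 + a * θ) ≤ w := by rw [div_le_iff₀ haθ]; exact hw
    refine le_trans (sub_le_sub_left this _) (le_of_eq ?_)
    field_simp; ring
  have hpow : x ^ (k - 1) ≤ θ ^ (k - 1) * Real.exp (((k : ℝ) - 1) / θ * (x - θ)) := by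
    have h2 : x ≤ θ * Real.exp ((x - θ) / θ) := by
      have h3 := Real.add_one_le_exp ((x - θ) / θ)
      calc x = θ * ((x - θ) / θ + 1) := by field_simp; ring
        _ ≤ _ := by gcongr
    calc x ^ (k - 1) ≤ (θ * Real.exp ((x - θ) / θ)) ^ (k - 1) := by gcongr
      _ = _ := by
        rw [mul_pow, ← Real.exp_nat_mul, Nat.cast_sub hk]
        push_cast; ring_nf
  have hlog := one_sub_div_pow_le_exp ν (by omega) hb0.le hab h1b0
  obtain ⟨l, rfl⟩ : ∃ l, k = l + 1 := ⟨k - 1, by omega⟩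
  simp only [Nat.add_sub_cancel] at hpow
  set K : ℝ := ((l + 1 : ℕ) : ℝ) with hK
  set d : ℝ := 1 - 2 * θ / (ν * (K + 1)) with hdd
  calc (K / x - w) * poissonExcess (l + 1 - 1) x
      ≤ (K / x - w) * (Real.exp (-x) * x ^ (l + 1) / (l + 1).factorial
          * (1 / (1 - 2 * x / (ν * (K + 1))) ^ ν)) := by
        gcongr
        exact poissonExcess_le (l + 1) ν hk (by omega) hν hx.le (by linarith)
    _ ≤ (K / (1 + a * θ) * (1 - a * (x - θ)) / x)
          * (Real.exp (-x) * x ^ (l + 1) / (l + 1).factorial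
          * (1 / (1 - 2 * x / (ν * (K + 1))) ^ ν)) := by
        have : 0 ≤ 1 - 2 * x / (ν * (K + 1)) := by rw [hd]; positivity
        gcongr
    _ = K / (1 + a * θ) / (l + 1).factorial * (1 / d ^ ν)
          * ((1 - a * (x - θ)) / (1 - b * (x - θ)) ^ ν) * (x ^ l * Real.exp (-x)) := by
        rw [hd, mul_pow, pow_succ]; field_simp
    _ ≤ K / (1 + a * θ) / (l + 1).factorial * (1 / d ^ ν)
          * Real.exp ((ν * b - a) * (x - θ))
          * (θ ^ l * Real.exp ((K - 1) / θ * (x - θ)) * Real.exp (-x)) := by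
        gcongr
    _ = K / (1 + a * θ) / (l + 1).factorial * (1 / d ^ ν) * θ ^ l
          * Real.exp ((ν * b - a) * (x - θ) + (K - 1) / θ * (x - θ) + -x) := by
        rw [Real.exp_add, Real.exp_add]; ring
    _ = K / (1 + a * θ) / (l + 1).factorial * (1 / d ^ ν) * θ ^ l * Real.exp (-θ) := by
        congr 2; rw [ha]; ring
    _ = _ := by rw [pow_succ]; field_simp

lemma exp_neg_div_twenty_le (n : ℕ) : Real.exp (-((n : ℝ) / 20)) ≤ 0.9512295 ^ n := by
  have h : Real.exp (-(1 / 20)) ≤ 0.9512295 := by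
    refine le_of_pow_le_pow_left₀ (n := 20) (by norm_num) (by norm_num) ?_
    rw [← Real.exp_nat_mul]
    have e : ((20 : ℕ) : ℝ) * (-(1 / 20)) = -1 := by norm_num
    rw [e]
    exact Real.exp_neg_one_lt_d9.le.trans (by norm_num)
  calc Real.exp (-((n : ℝ) / 20)) = Real.exp (-(1 / 20)) ^ n := by
        rw [← Real.exp_nat_mul]; ring_nf
    _ ≤ _ := by gcongr

/-- The bound of `mul_poissonExcess_le_tangent` at `θ = n / 20`, with all hypotheses reduced to
rational arithmetic. -/
lemma mul_poissonExcess_le_of_rat (k ν n : ℕ) {w a Δ : ℝ} (hw1 : 1 ≤ w)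
    (ha : a = ((k : ℝ) - 1) / (n / 20) - 1 + ν * (2 / (ν * (k + 1) - 2 * (n / 20))))
    (hw : k * a ≤ w * (1 + a * (n / 20)))
    (hΔ : k / ((n / 20 : ℝ) * (1 + a * (n / 20))) * ((n / 20) ^ k * 0.9512295 ^ n / k.factorial)
        * (1 / (1 - 2 * (n / 20) / (ν * (k + 1))) ^ ν) ≤ Δ) {x : ℝ} (hx : 0 < x)
    (hk : 1 ≤ k := by norm_num) (hν2 : 2 ≤ ν := by norm_num)
    (hν : ν * (k - 1) ≤ 2 * (k + 2) := by norm_num) (hθ : 0 < n := by norm_num)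
    (hθk : (n : ℝ) / 20 ≤ (k : ℝ) - 1 := by norm_num) :
    ((k : ℝ) / x - w) * poissonExcess (k - 1) x ≤ Δ := by
  have hn : (0 : ℝ) < n := by exact_mod_cast hθ
  have hν2' : (2 : ℝ) ≤ ν := by exact_mod_cast hν2
  have hmk : 2 * ((k : ℝ) + 1) ≤ ν * (k + 1) := by gcongr
  have ha0 : 0 ≤ a := by
    rw [ha]
    have : 1 ≤ ((k : ℝ) - 1) / (n / 20) := by rw [le_div_iff₀ (by positivity)]; linarith
    have : 0 ≤ (ν : ℝ) * (2 / (ν * (k + 1) - 2 * (n / 20))) := by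
      have : 0 ≤ (ν : ℝ) * (k + 1) - 2 * (n / 20) := by linarith
      positivity
    linarith
  have hd0 : 0 ≤ 1 - 2 * ((n : ℝ) / 20) / (ν * ((k : ℝ) + 1)) := by
    rw [sub_nonneg, div_le_one (by positivity)]; linarith
  refine (mul_poissonExcess_le_tangent k ν hk hν2 hν (by positivity) hθk hw1 ha hw hx).trans
    (le_trans ?_ hΔ)
  gcongr
  exact exp_neg_div_twenty_le n

/-- A bound for `(k / x - w) * poissonExcess (k - 1) x` that decays geometrically in `k`. -/
lemma mul_poissonExcess_le_decay (k : ℕ) {w W : ℝ} (hk : 1 ≤ k) (hW : 1 < W) (hw : W ≤ w)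
    (hβ : 0 < ((k : ℝ) - 1) / k - 1 / W) {x : ℝ} (hx : 0 < x) :
    ((k : ℝ) / x - w) * poissonExcess (k - 1) x
      ≤ (W / (W - 1)) ^ 2 * ((k / W) ^ (k - 1) * Real.exp (-(k / W)) / k.factorial)
        * (Real.exp (-1) / (((k : ℝ) - 1) / k - 1 / W)) := by
  have hk1 : (1 : ℝ) ≤ k := by exact_mod_cast hk
  have hW0 : 0 < W := by linarith
  have hW1 : 0 < W - 1 := by linarith
  set β : ℝ := ((k : ℝ) - 1) / k - 1 / W with hβdef
  have hψ := poissonExcess_nonneg (k - 1) hx.le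
  rcases le_or_gt ((k : ℝ) / x - W) 0 with hneg | hpos
  · exact (mul_nonpos_of_nonpos_of_nonneg (by linarith) hψ).trans (by positivity)
  set y : ℝ := k - W * x with hy
  have hxk : W * x < k := by
    have h1 : W < (k : ℝ) / x := by linarith
    rwa [lt_div_iff₀ hx] at h1
  have hy0 : 0 < y := by linarith
  have hxeq : x = k / W * (1 - y / k) := by rw [hy]; field_simp; ring
  have hyk : 0 ≤ 1 - y / k := by
    rw [sub_nonneg, div_le_one (by linarith), hy]; nlinarith
  have hxk1 : x < k + 1 := by nlinarith
  have hD : (W - 1) / W ≤ 1 - 2 * x / ((2 : ℕ) * ((k : ℝ) + 1)) := by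
    have : x / (k + 1) ≤ 1 / W := by
      rw [div_le_div_iff₀ (by positivity) hW0]; nlinarith
    have e1 : (W - 1) / W = 1 - 1 / W := by field_simp
    have e2 : 2 * x / (((2 : ℕ) : ℝ) * ((k : ℝ) + 1)) = x / (k + 1) := by
      push_cast; field_simp
    rw [e1, e2]; linarith
  have hD2 : 1 / (1 - 2 * x / ((2 : ℕ) * ((k : ℝ) + 1))) ^ 2 ≤ (W / (W - 1)) ^ 2 := by
    calc 1 / (1 - 2 * x / ((2 : ℕ) * ((k : ℝ) + 1))) ^ 2 ≤ 1 / ((W - 1) / W) ^ 2 := by gcongr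
      _ = _ := by field_simp
  have hpow : x ^ (k - 1) ≤ (k / W) ^ (k - 1) * Real.exp (-(((k : ℝ) - 1) / k * y)) := by
    have h2 : x ≤ k / W * Real.exp (-(y / k)) := by
      have h3 := Real.add_one_le_exp (-(y / k))
      calc x = k / W * (-(y / k) + 1) := by rw [hxeq]; ring
        _ ≤ _ := by gcongr
    calc x ^ (k - 1) ≤ (k / W * Real.exp (-(y / k))) ^ (k - 1) := by gcongr
      _ = _ := by
        rw [mul_pow, ← Real.exp_nat_mul, Nat.cast_sub hk]
        push_cast; ring_nf
  have hye : y * Real.exp (-(β * y)) ≤ Real.exp (-1) / β := by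
    have h3 := Real.add_one_le_exp (β * y - 1)
    rw [le_div_iff₀ hβ]
    calc y * Real.exp (-(β * y)) * β = (β * y - 1 + 1) * Real.exp (-(β * y)) := by ring
      _ ≤ Real.exp (β * y - 1) * Real.exp (-(β * y)) := by gcongr
      _ = Real.exp (-1) := by rw [← Real.exp_add]; ring_nf
  obtain ⟨l, rfl⟩ : ∃ l, k = l + 1 := ⟨k - 1, by omega⟩
  simp only [Nat.add_sub_cancel] at hpow ⊢
  set K : ℝ := ((l + 1 : ℕ) : ℝ) with hK
  calc (K / x - w) * poissonExcess l x
      ≤ (K / x - W) * (Real.exp (-x) * x ^ (l + 1) / (l + 1).factorial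
          * (1 / (1 - 2 * x / ((2 : ℕ) * (K + 1))) ^ 2)) := by
        have h5 := poissonExcess_le (l + 1) 2 hk (by omega) (by omega) hx.le
          (by rw [Nat.cast_ofNat]; linarith)
        simp only [Nat.add_sub_cancel] at h5 hψ
        gcongr
    _ ≤ (K / x - W) * (Real.exp (-x) * x ^ (l + 1) / (l + 1).factorial * (W / (W - 1)) ^ 2) := by
        gcongr
    _ = (W / (W - 1)) ^ 2 / (l + 1).factorial * y * (x ^ l * Real.exp (-x)) := by
        rw [hy, pow_succ]; field_simp
    _ ≤ (W / (W - 1)) ^ 2 / (l + 1).factorial * y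
          * ((K / W) ^ l * Real.exp (-((K - 1) / K * y)) * Real.exp (-x)) := by gcongr
    _ = (W / (W - 1)) ^ 2 / (l + 1).factorial * (K / W) ^ l * Real.exp (-(K / W))
          * (y * Real.exp (-(β * y))) := by
        have : Real.exp (-((K - 1) / K * y)) * Real.exp (-x)
            = Real.exp (-(K / W)) * Real.exp (-(β * y)) := by
          rw [← Real.exp_add, ← Real.exp_add]
          congr 1
          have : x = K / W - y / W := by rw [hy]; field_simp; ring
          rw [this, hβdef]; ring
        linear_combination ((W / (W - 1)) ^ 2 / (l + 1).factorial * y * (K / W) ^ l) * this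
    _ ≤ (W / (W - 1)) ^ 2 / (l + 1).factorial * (K / W) ^ l * Real.exp (-(K / W))
          * (Real.exp (-1) / β) := by gcongr
    _ = _ := by ring

/-- Geometric decay of the sequence in `mul_poissonExcess_le_decay`. -/
lemma pow_exp_div_factorial_succ_le (k : ℕ) {W : ℝ} (hk : 1 ≤ k) (hW : 0 < W) :
    (((k + 1 : ℕ) : ℝ) / W) ^ k * Real.exp (-(((k + 1 : ℕ) : ℝ) / W)) / (k + 1).factorial
      ≤ Real.exp (1 - 1 / W) / W
        * ((k / W) ^ (k - 1) * Real.exp (-(k / W)) / k.factorial) := by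
  have hk0 : (0 : ℝ) < k := by exact_mod_cast hk
  have h1 : (((k + 1 : ℕ) : ℝ) / k) ^ (k - 1) ≤ Real.exp 1 := by
    have h2 : ((k + 1 : ℕ) : ℝ) / k ≤ Real.exp (1 / k) := by
      have := Real.add_one_le_exp (1 / (k : ℝ))
      refine le_trans (le_of_eq ?_) this
      push_cast; field_simp; ring
    calc (((k + 1 : ℕ) : ℝ) / k) ^ (k - 1) ≤ Real.exp (1 / k) ^ (k - 1) := by gcongr
      _ = Real.exp (((k - 1 : ℕ) : ℝ) * (1 / k)) := by rw [← Real.exp_nat_mul]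
      _ ≤ Real.exp 1 := by
        apply Real.exp_le_exp.2
        rw [mul_one_div, div_le_one hk0]
        exact_mod_cast Nat.sub_le k 1
  obtain ⟨l, rfl⟩ : ∃ l, k = l + 1 := ⟨k - 1, by omega⟩
  simp only [Nat.add_sub_cancel] at h1 ⊢
  have e : Real.exp (-(((l + 1 + 1 : ℕ) : ℝ) / W))
      = Real.exp (-(((l + 1 : ℕ) : ℝ) / W)) * Real.exp (-(1 / W)) := by
    rw [← Real.exp_add]; push_cast; ring_nf
  have e2 : (((l + 1 + 1 : ℕ) : ℝ) / W) ^ (l + 1) / (l + 1 + 1).factorial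
      = (((l + 1 + 1 : ℕ) : ℝ) / ((l + 1 : ℕ) : ℝ)) ^ l * ((((l + 1 : ℕ) : ℝ) / W) ^ l
        / (l + 1).factorial) / W := by
    rw [Nat.factorial_succ (l + 1), div_pow, div_pow, div_pow, pow_succ, pow_succ]
    push_cast
    field_simp
  rw [show (1 : ℝ) - 1 / W = 1 + -(1 / W) by ring, Real.exp_add, e]
  calc (((l + 1 + 1 : ℕ) : ℝ) / W) ^ (l + 1)
        * (Real.exp (-(((l + 1 : ℕ) : ℝ) / W)) * Real.exp (-(1 / W))) / (l + 1 + 1).factorial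
      = (((l + 1 + 1 : ℕ) : ℝ) / ((l + 1 : ℕ) : ℝ)) ^ l * ((((l + 1 : ℕ) : ℝ) / W) ^ l
        / (l + 1).factorial / W
        * (Real.exp (-(((l + 1 : ℕ) : ℝ) / W)) * Real.exp (-(1 / W)))) := by
        linear_combination (Real.exp (-(((l + 1 : ℕ) : ℝ) / W)) * Real.exp (-(1 / W))) * e2
    _ ≤ Real.exp 1 * ((((l + 1 : ℕ) : ℝ) / W) ^ l / (l + 1).factorial / W
        * (Real.exp (-(((l + 1 : ℕ) : ℝ) / W)) * Real.exp (-(1 / W)))) := by gcongr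
    _ = _ := by ring

/-! ### The budget -/

/-- Increments of the budget: `budgetStep k` bounds
`((k + 1) / x - budget k) * poissonExcess k x` over all `x > 0`.  The first fifteen values are
provable bounds rounded up; from there on the values are geometric, where the ratio `0.8481` comes
from `exp_const_le`. -/
noncomputable def budgetStep : ℕ → ℝ
  | 0 => 1
  | 1 => 0.3905
  | 2 => 0.1889
  | 3 => 0.1082
  | 4 => 0.0666
  | 5 => 0.0423
  | 6 => 0.0295
  | 7 => 0.0221
  | 8 => 0.0151
  | 9 => 0.0111
  | 10 => 0.0083
  | 11 => 0.0062
  | 12 => 0.0047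
  | 13 => 0.0036
  | 14 => 0.0027
  | n + 15 => 0.0036 * 0.8481 ^ n

/-- The sum of the first `k` increments: an upper bound for the contribution of `{V ≤ k}` to the
expectation of `V / x V`, relative to `P (V ≤ k)`, where `V` is the value of a step-up procedure. -/
noncomputable def budget (k : ℕ) : ℝ := ∑ i ∈ Finset.range k, budgetStep i

lemma budgetStep_nonneg (k : ℕ) : 0 ≤ budgetStep k := by
  unfold budgetStep
  split <;> positivity

lemma budget_mono : Monotone budget := fun _ _ h =>
  Finset.sum_le_sum_of_subset_of_nonneg (Finset.range_mono h) fun i _ _ => budgetStep_nonneg i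

lemma one_le_budget {k : ℕ} (hk : 1 ≤ k) : 1 ≤ budget k := by
  refine le_trans (le_of_eq ?_) (budget_mono hk)
  simp [budget, budgetStep]

lemma budget_fifteen : budget 15 = 1.8998 := by
  simp only [budget, Finset.sum_range_succ, Finset.sum_range_zero, budgetStep]
  norm_num

lemma budget_le (k : ℕ) : budget k ≤ 1.93 := by
  refine (budget_mono (Nat.le_add_left k 15)).trans ?_
  have h1 : budget (15 + k) = budget 15 + 0.0036 * ∑ i ∈ Finset.range k, (0.8481 : ℝ) ^ i := by
    rw [budget, Finset.sum_range_add, budget, Finset.mul_sum]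
    congr 1
    refine Finset.sum_congr rfl fun i _ => ?_
    rw [Nat.add_comm 15 i]; rfl
  have h2 : ∑ i ∈ Finset.range k, (0.8481 : ℝ) ^ i ≤ (1 - 0.8481)⁻¹ := by
    rw [← tsum_geometric_of_lt_one (by norm_num) (by norm_num)]
    exact (summable_geometric_of_lt_one (by norm_num) (by norm_num)).sum_le_tsum _
      fun i _ => by positivity
  rw [h1, budget_fifteen]
  have h3 : (1.8998 : ℝ) + 0.0036 * (1 - 0.8481)⁻¹ ≤ 1.93 := by norm_num
  nlinarith

/-- The ratio of the geometric decay from stage `15` on; `100 / 53 ≈ 1.887` is a convenient lower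
bound for `budget 15 = 1.8998`. -/
lemma exp_const_le : Real.exp (1 - 1 / (100 / 53)) / (100 / 53) ≤ 0.8481 := by
  have h : Real.exp (47 / 100) ≤ 1.6001 := by
    refine le_of_pow_le_pow_left₀ (n := 100) (by norm_num) (by norm_num) ?_
    rw [← Real.exp_nat_mul]
    have e : ((100 : ℕ) : ℝ) * (47 / 100) = ((47 : ℕ) : ℝ) * 1 := by norm_num
    rw [e, Real.exp_nat_mul]
    calc Real.exp 1 ^ 47 ≤ 2.7182818286 ^ 47 := by gcongr; exact Real.exp_one_lt_d9.le
      _ ≤ _ := by norm_num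
  have e : (1 : ℝ) - 1 / (100 / 53) = 47 / 100 := by norm_num
  rw [e]
  linarith

lemma decay_initial_le :
    ((100 / 53 : ℝ) / (100 / 53 - 1)) ^ 2
      * (((16 : ℕ) / (100 / 53) : ℝ) ^ (16 - 1) * Real.exp (-(((16 : ℕ) : ℝ) / (100 / 53)))
        / (16 : ℕ).factorial)
      * (Real.exp (-1) / ((((16 : ℕ) : ℝ) - 1) / (16 : ℕ) - 1 / (100 / 53))) ≤ 0.0036 := by
  have h1 : Real.exp (-(((16 : ℕ) : ℝ) / (100 / 53))) ≤ 0.9512295 ^ 169 := by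
    refine le_trans (Real.exp_le_exp.2 ?_) (exp_neg_div_twenty_le 169)
    norm_num
  have h2 : Real.exp (-1) ≤ 0.3678794412 := Real.exp_neg_one_lt_d9.le
  have h3 : (0 : ℝ) ≤ ((((16 : ℕ) : ℝ) - 1) / (16 : ℕ) - 1 / (100 / 53)) := by norm_num
  calc _ ≤ ((100 / 53 : ℝ) / (100 / 53 - 1)) ^ 2
      * (((16 : ℕ) / (100 / 53) : ℝ) ^ (16 - 1) * 0.9512295 ^ 169 / (16 : ℕ).factorial)
      * (0.3678794412 / ((((16 : ℕ) : ℝ) - 1) / (16 : ℕ) - 1 / (100 / 53))) := by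
        gcongr
    _ ≤ 0.0036 := by
      norm_num [Nat.factorial]

lemma decay_le (n : ℕ) {w x : ℝ} (hw : 100 / 53 ≤ w) (hx : 0 < x) :
    (((n + 16 : ℕ) : ℝ) / x - w) * poissonExcess (n + 15) x ≤ 0.0036 * 0.8481 ^ n := by
  have hk : (((16 : ℕ) : ℝ) - 1) / (16 : ℕ) ≤ (((n + 16 : ℕ) : ℝ) - 1) / (n + 16 : ℕ) := by
    rw [div_le_div_iff₀ (by positivity) (by positivity)]
    push_cast
    have : (0 : ℝ) ≤ n := n.cast_nonneg
    linarith
  have h0 : (0 : ℝ) < (((16 : ℕ) : ℝ) - 1) / (16 : ℕ) - 1 / (100 / 53) := by norm_num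
  have h := mul_poissonExcess_le_decay (n + 16) (W := 100 / 53) (by omega) (by norm_num) hw
    (by linarith) hx
  rw [show n + 16 - 1 = n + 15 by omega] at h
  set c : ℕ → ℝ := fun k =>
    ((k : ℝ) / (100 / 53)) ^ (k - 1) * Real.exp (-((k : ℝ) / (100 / 53))) / k.factorial with hc
  have hgeo : c (n + 16) ≤ 0.8481 ^ n * c 16 := by
    clear h hk
    induction n with
    | zero => simp
    | succ n ih =>
      have h1 := pow_exp_div_factorial_succ_le (n + 16) (W := 100 / 53) (by omega) (by norm_num)
      have h2 : c (n + 1 + 16) ≤ Real.exp (1 - 1 / (100 / 53)) / (100 / 53) * c (n + 16) := by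
        rw [show n + 1 + 16 = n + 16 + 1 by ring]; exact h1
      have hc0 : 0 ≤ c (n + 16) := by simp only [hc]; positivity
      calc c (n + 1 + 16) ≤ 0.8481 * c (n + 16) :=
            h2.trans (mul_le_mul_of_nonneg_right exp_const_le hc0)
        _ ≤ 0.8481 * (0.8481 ^ n * c 16) := by gcongr
        _ = _ := by ring
  refine h.trans ?_
  calc ((100 / 53 : ℝ) / (100 / 53 - 1)) ^ 2 * c (n + 16)
        * (Real.exp (-1) / ((((n + 16 : ℕ) : ℝ) - 1) / (n + 16 : ℕ) - 1 / (100 / 53)))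
      ≤ ((100 / 53 : ℝ) / (100 / 53 - 1)) ^ 2 * (0.8481 ^ n * c 16)
        * (Real.exp (-1) / ((((16 : ℕ) : ℝ) - 1) / (16 : ℕ) - 1 / (100 / 53))) := by
        have h1 : 0 ≤ 0.8481 ^ n * c 16 := by simp only [hc]; positivity
        have h2 := h0.trans_le (sub_le_sub_right hk _)
        have h3 : 0 ≤ Real.exp (-1)
            / ((((n + 16 : ℕ) : ℝ) - 1) / (n + 16 : ℕ) - 1 / (100 / 53)) := by positivity
        gcongr
    _ = 0.8481 ^ n * (((100 / 53 : ℝ) / (100 / 53 - 1)) ^ 2 * c 16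
        * (Real.exp (-1) / ((((16 : ℕ) : ℝ) - 1) / (16 : ℕ) - 1 / (100 / 53)))) := by ring
    _ ≤ 0.8481 ^ n * 0.0036 := by
      gcongr
      exact decay_initial_le
    _ = _ := by ring

/-- The numerical heart of the bound: the budget covers the gain of every stage. -/
lemma mul_poissonExcess_le_budgetStep (k : ℕ) {x : ℝ} (hx : 0 < x) :
    (((k + 1 : ℕ) : ℝ) / x - budget k) * poissonExcess k x ≤ budgetStep k := by
  -- The case `k = 0` is exact.  In the explicit cases below the three numerals are `k + 1`, the
  -- largest admissible exponent `ν`, and `n` such that `n / 20` is close to the maximiser.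
  match k with
  | 0 => simp [budget, budgetStep, poissonExcess_zero, hx.ne']
  | 1 =>
    refine mul_poissonExcess_le_of_rat 2 8 18 (one_le_budget (by norm_num)) rfl ?_ ?_ hx <;>
      norm_num [budget, budgetStep, Finset.sum_range_succ, Nat.factorial]
  | 2 =>
    refine mul_poissonExcess_le_of_rat 3 5 26 (one_le_budget (by norm_num)) rfl ?_ ?_ hx <;>
      norm_num [budget, budgetStep, Finset.sum_range_succ, Nat.factorial]
  | 3 =>
    refine mul_poissonExcess_le_of_rat 4 4 35 (one_le_budget (by norm_num)) rfl ?_ ?_ hx <;>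
      norm_num [budget, budgetStep, Finset.sum_range_succ, Nat.factorial]
  | 4 =>
    refine mul_poissonExcess_le_of_rat 5 3 44 (one_le_budget (by norm_num)) rfl ?_ ?_ hx <;>
      norm_num [budget, budgetStep, Finset.sum_range_succ, Nat.factorial]
  | 5 =>
    refine mul_poissonExcess_le_of_rat 6 3 53 (one_le_budget (by norm_num)) rfl ?_ ?_ hx <;>
      norm_num [budget, budgetStep, Finset.sum_range_succ, Nat.factorial]
  | 6 =>
    refine mul_poissonExcess_le_of_rat 7 3 63 (one_le_budget (by norm_num)) rfl ?_ ?_ hx <;>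
      norm_num [budget, budgetStep, Finset.sum_range_succ, Nat.factorial]
  | 7 =>
    refine mul_poissonExcess_le_of_rat 8 2 73 (one_le_budget (by norm_num)) rfl ?_ ?_ hx <;>
      norm_num [budget, budgetStep, Finset.sum_range_succ, Nat.factorial]
  | 8 =>
    refine mul_poissonExcess_le_of_rat 9 2 82 (one_le_budget (by norm_num)) rfl ?_ ?_ hx <;>
      norm_num [budget, budgetStep, Finset.sum_range_succ, Nat.factorial]
  | 9 =>
    refine mul_poissonExcess_le_of_rat 10 2 92 (one_le_budget (by norm_num)) rfl ?_ ?_ hx <;>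
      norm_num [budget, budgetStep, Finset.sum_range_succ, Nat.factorial]
  | 10 =>
    refine mul_poissonExcess_le_of_rat 11 2 102 (one_le_budget (by norm_num)) rfl ?_ ?_ hx <;>
      norm_num [budget, budgetStep, Finset.sum_range_succ, Nat.factorial]
  | 11 =>
    refine mul_poissonExcess_le_of_rat 12 2 112 (one_le_budget (by norm_num)) rfl ?_ ?_ hx <;>
      norm_num [budget, budgetStep, Finset.sum_range_succ, Nat.factorial]
  | 12 =>
    refine mul_poissonExcess_le_of_rat 13 2 122 (one_le_budget (by norm_num)) rfl ?_ ?_ hx <;>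
      norm_num [budget, budgetStep, Finset.sum_range_succ, Nat.factorial]
  | 13 =>
    refine mul_poissonExcess_le_of_rat 14 2 132 (one_le_budget (by norm_num)) rfl ?_ ?_ hx <;>
      norm_num [budget, budgetStep, Finset.sum_range_succ, Nat.factorial]
  | 14 =>
    refine mul_poissonExcess_le_of_rat 15 2 142 (one_le_budget (by norm_num)) rfl ?_ ?_ hx <;>
      norm_num [budget, budgetStep, Finset.sum_range_succ, Nat.factorial]
  | n + 15 =>
    refine decay_le n ?_ hx
    refine le_trans ?_ (budget_mono (Nat.le_add_left 15 n))
    rw [budget_fifteen]; norm_num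

/-! ### Step-up procedures on independent levels -/

/-- A sum of independent Bernoulli variables has smaller stop-loss expectations than the Poisson
variable with the same mean. -/
lemma integral_max_sum_sub_le {Ω ι : Type*} [MeasurableSpace Ω] {μ : Measure Ω}
    [IsProbabilityMeasure μ] {X : ι → Ω → ℝ} (hX : ∀ i, Measurable (X i))
    (h01 : ∀ i ω, X i ω = 0 ∨ X i ω = 1) (hind : iIndepFun X μ) (s : Finset ι) (k : ℕ) :
    ∫ ω, max (∑ i ∈ s, X i ω - k) 0 ∂μ ≤ poissonExcess k (∑ i ∈ s, ∫ ω, X i ω ∂μ) := by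
  classical
  have hX0 : ∀ i ω, 0 ≤ X i ω := fun i ω => by rcases h01 i ω with h | h <;> simp [h]
  have hX1 : ∀ i ω, X i ω ≤ 1 := fun i ω => by rcases h01 i ω with h | h <;> simp [h]
  have hintX : ∀ i, Integrable (X i) μ := fun i =>
    Integrable.of_bound (hX i).aestronglyMeasurable 1 (ae_of_all _ fun ω => by
      rw [Real.norm_of_nonneg (hX0 i ω)]; exact hX1 i ω)
  have hS0 : ∀ (s : Finset ι) ω, 0 ≤ ∑ i ∈ s, X i ω := fun s ω =>
    Finset.sum_nonneg fun i _ => hX0 i ω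
  have hmeas : ∀ (s : Finset ι) (k : ℕ), Measurable fun ω => max (∑ i ∈ s, X i ω - k) 0 :=
    fun s k => ((Finset.measurable_sum s fun i _ => hX i).sub_const _).max measurable_const
  have hint : ∀ (s : Finset ι) (k : ℕ), Integrable (fun ω => max (∑ i ∈ s, X i ω - k) 0) μ := by
    intro s k
    refine Integrable.of_bound (hmeas s k).aestronglyMeasurable (s.card : ℝ) (ae_of_all _ fun ω => ?_)
    rw [Real.norm_of_nonneg (le_max_right _ _)]
    refine max_le ?_ (by positivity)
    have : ∑ i ∈ s, X i ω ≤ ∑ i ∈ s, (1 : ℝ) := Finset.sum_le_sum fun i _ => hX1 i ω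
    simp only [Finset.sum_const, nsmul_eq_mul, mul_one] at this
    have : (0 : ℝ) ≤ k := k.cast_nonneg
    linarith
  induction s using Finset.induction_on generalizing k with
  | empty => simp [poissonExcess_zero_right]
  | insert i s hi ih =>
    rcases k with _ | k
    · rw [poissonExcess_zero, ← integral_finsetSum _ fun i _ => hintX i]
      refine le_of_eq (integral_congr_ae (ae_of_all _ fun ω => ?_))
      simpa using hS0 (insert i s) ω
    have hindep : ∀ j : ℕ, ∫ ω, X i ω * max (∑ l ∈ s, X l ω - j) 0 ∂μ
        = (∫ ω, X i ω ∂μ) * ∫ ω, max (∑ l ∈ s, X l ω - j) 0 ∂μ := by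
      intro j
      have h1 : IndepFun (X i) (fun ω => max ((∑ l ∈ s, X l) ω - j) 0) μ :=
        ((hind.indepFun_finsetSum_of_notMem hX hi).comp
          (φ := fun u : ℝ => max (u - j) 0) (ψ := id)
          ((measurable_id.sub_const _).max measurable_const) measurable_id).symm
      simp only [Finset.sum_apply] at h1
      exact h1.integral_fun_mul_eq_mul_integral (hX i).aestronglyMeasurable
        (hmeas s j).aestronglyMeasurable
    have hintmul : ∀ j : ℕ, Integrable (fun ω => X i ω * max (∑ l ∈ s, X l ω - j) 0) μ := by
      intro j
      refine (hint s j).mono ((hX i).mul (hmeas s j)).aestronglyMeasurable (ae_of_all _ fun ω => ?_)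
      rw [norm_mul, Real.norm_of_nonneg (hX0 i ω)]
      exact mul_le_of_le_one_left (norm_nonneg _) (hX1 i ω)
    have hsplit : ∀ ω, max (∑ l ∈ insert i s, X l ω - (k + 1 : ℕ)) 0
        = max (∑ l ∈ s, X l ω - (k + 1 : ℕ)) 0
          - X i ω * max (∑ l ∈ s, X l ω - (k + 1 : ℕ)) 0
          + X i ω * max (∑ l ∈ s, X l ω - k) 0 := by
      intro ω
      rw [Finset.sum_insert hi]
      rcases h01 i ω with h | h
      · simp [h]
      · rw [h]; push_cast
        rw [show 1 + ∑ l ∈ s, X l ω - ((k : ℝ) + 1) = ∑ l ∈ s, X l ω - k by ring]; ring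
    have hw0 : 0 ≤ ∫ ω, X i ω ∂μ := integral_nonneg fun ω => hX0 i ω
    have hw1 : ∫ ω, X i ω ∂μ ≤ 1 := by
      have := integral_mono (hintX i) (integrable_const (1 : ℝ)) fun ω => hX1 i ω
      simpa using this
    have hx0 : 0 ≤ ∑ l ∈ s, ∫ ω, X l ω ∂μ :=
      Finset.sum_nonneg fun l _ => integral_nonneg fun ω => hX0 l ω
    simp_rw [hsplit]
    have e1 : ∫ ω, (max (∑ l ∈ s, X l ω - (k + 1 : ℕ)) 0
          - X i ω * max (∑ l ∈ s, X l ω - (k + 1 : ℕ)) 0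
          + X i ω * max (∑ l ∈ s, X l ω - k) 0) ∂μ
        = (1 - ∫ ω, X i ω ∂μ) * ∫ ω, max (∑ l ∈ s, X l ω - (k + 1 : ℕ)) 0 ∂μ
          + (∫ ω, X i ω ∂μ) * ∫ ω, max (∑ l ∈ s, X l ω - k) 0 ∂μ := by
      have hsub : Integrable (fun ω => max (∑ l ∈ s, X l ω - (k + 1 : ℕ)) 0
          - X i ω * max (∑ l ∈ s, X l ω - (k + 1 : ℕ)) 0) μ :=
        (hint s (k + 1)).sub (hintmul (k + 1))
      rw [integral_add hsub (hintmul k),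
        integral_sub (hint s (k + 1)) (hintmul (k + 1)), hindep, hindep]
      ring
    rw [e1, Finset.sum_insert hi, add_comm (∫ ω, X i ω ∂μ)]
    refine le_trans ?_ (bernoulli_step_le k hx0 hw0)
    have := ih k
    have := ih (k + 1)
    have : 0 ≤ 1 - ∫ ω, X i ω ∂μ := by linarith
    gcongr

section Levels

variable {Ω ι : Type*} [MeasurableSpace Ω] {μ : Measure Ω} [IsProbabilityMeasure μ] [Fintype ι]
  {L : ℕ} {K : ι → Ω → Fin L}

/-- The number of indices whose level is at most `r`. -/
def levelCount {ι : Type*} [Fintype ι] {L : ℕ} (a : ι → Fin L) (r : ℕ) : ℕ :=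
  (Finset.univ.filter fun i => (a i : ℕ) ≤ r).card

lemma levelCount_anti {a b : ι → Fin L} (hab : a ≤ b) (r : ℕ) : levelCount b r ≤ levelCount a r :=
  Finset.card_le_card fun i hi => by
    simp only [Finset.mem_filter, Finset.mem_univ, true_and] at hi ⊢
    exact le_trans (hab i) hi

lemma levelCount_mono (a : ι → Fin L) : Monotone (levelCount a) := fun _ _ h =>
  Finset.card_le_card fun i hi => by
    simp only [Finset.mem_filter, Finset.mem_univ, true_and] at hi ⊢
    exact hi.trans h

/-- Markov's inequality for the excess over `k`, combined with the Poisson comparison. -/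
lemma measureReal_levelCount_le (hK : ∀ i, Measurable (K i)) (hind : iIndepFun K μ) (r k : ℕ) :
    μ.real {ω | k + 1 ≤ levelCount (fun i => K i ω) r}
      ≤ poissonExcess k (∑ i, μ.real {ω | (K i ω : ℕ) ≤ r}) := by
  classical
  set g : Fin L → ℝ := fun l => if (l : ℕ) ≤ r then 1 else 0 with hg
  have hgm : Measurable g := measurable_of_finite g
  have hX : ∀ i, Measurable fun ω => g (K i ω) := fun i => hgm.comp (hK i)
  have h := integral_max_sum_sub_le hX (fun i ω => by simp only [hg]; split_ifs <;> simp)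
    (hind.comp (fun _ => g) fun _ => hgm) Finset.univ k
  have hmean : ∀ i, ∫ ω, g (K i ω) ∂μ = μ.real {ω | (K i ω : ℕ) ≤ r} := by
    intro i
    have hm : MeasurableSet {ω | (K i ω : ℕ) ≤ r} :=
      hK i (Set.toFinite {l : Fin L | (l : ℕ) ≤ r}).measurableSet
    rw [← integral_indicator_one hm]
    refine integral_congr_ae (ae_of_all _ fun ω => ?_)
    simp [hg, Set.indicator_apply]
  have hcount : ∀ ω, ∑ i, g (K i ω) = levelCount (fun i => K i ω) r := by
    intro ω; simp [hg, levelCount, Finset.sum_boole]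
  simp_rw [hmean, hcount] at h
  refine le_trans ?_ h
  have hKm : Measurable fun ω => fun i => K i ω := measurable_pi_lambda _ hK
  have hm : MeasurableSet {ω | k + 1 ≤ levelCount (fun i => K i ω) r} :=
    hKm (Set.toFinite {a : ι → Fin L | k + 1 ≤ levelCount a r}).measurableSet
  rw [← integral_indicator_one hm]
  refine integral_mono_of_nonneg (ae_of_all _ fun ω => Set.indicator_nonneg (by simp) _) ?_
    (ae_of_all _ fun ω => ?_)
  · have : Measurable fun a : ι → Fin L => max ((levelCount a r : ℝ) - k) 0 :=
      measurable_of_finite _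
    refine Integrable.of_bound (this.comp hKm).aestronglyMeasurable (Fintype.card ι : ℝ)
      (ae_of_all _ fun ω => ?_)
    rw [Real.norm_of_nonneg (le_max_right _ _)]
    have h1 : (levelCount (fun i => K i ω) r : ℝ) ≤ Fintype.card ι := by
      exact_mod_cast Finset.card_le_univ _
    have : (0 : ℝ) ≤ k := k.cast_nonneg
    exact max_le (by linarith) (by positivity)
  · by_cases hω : k + 1 ≤ levelCount (fun i => K i ω) r
    · have : ((k : ℝ) + 1) ≤ levelCount (fun i => K i ω) r := by exact_mod_cast hω
      simp only [Set.indicator_apply, Set.mem_ofPred_eq, hω, if_true, Pi.one_apply]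
      exact le_max_of_le_left (by linarith)
    · rw [Set.indicator_of_notMem (show ω ∉ {ω | k + 1 ≤ levelCount (fun i => K i ω) r} from hω)]
      exact le_max_right _ _

/-- Harris' inequality for independent finite-valued variables: a lower set and an upper set are
negatively correlated. -/
lemma measureReal_inter_le_mul (hK : ∀ i, Measurable (K i)) (hind : iIndepFun K μ)
    {S T : Set (ι → Fin L)} (hS : IsLowerSet S) (hT : IsUpperSet T) :
    μ.real {ω | (fun i => K i ω) ∈ S ∩ T}
      ≤ μ.real {ω | (fun i => K i ω) ∈ S} * μ.real {ω | (fun i => K i ω) ∈ T} := by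
  classical
  set w : (ι → Fin L) → ℝ := fun a => ∏ i, μ.real (K i ⁻¹' {a i}) with hw
  have hKm : Measurable fun ω => fun i => K i ω := measurable_pi_lambda _ hK
  have hatom : ∀ a, μ.real ((fun ω i => K i ω) ⁻¹' {a}) = w a := by
    intro a
    have h1 : (fun ω i => K i ω) ⁻¹' {a} = ⋂ i ∈ Finset.univ, K i ⁻¹' {a i} := by
      ext ω; simp [funext_iff]
    rw [h1, measureReal_def, hind.measure_inter_preimage_eq_mul Finset.univ
      (fun i _ => measurableSet_singleton _), ENNReal.toReal_prod]
    rfl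
  have hlaw : ∀ U : Set (ι → Fin L),
      μ.real {ω | (fun i => K i ω) ∈ U} = ∑ a, w a * U.indicator 1 a := by
    intro U
    have h1 := sum_measureReal_preimage_singleton (μ := μ) (f := fun ω i => K i ω)
      (Finset.univ.filter (· ∈ U)) (fun a _ => hKm (measurableSet_singleton a))
    simp_rw [hatom] at h1
    rw [Finset.sum_filter] at h1
    have h2 : (fun ω i => K i ω) ⁻¹' ((Finset.univ.filter (· ∈ U) : Finset (ι → Fin L)) : Set _)
        = {ω | (fun i => K i ω) ∈ U} := by ext ω; simp
    rw [h2] at h1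
    rw [← h1]
    refine Finset.sum_congr rfl fun a _ => ?_
    by_cases ha : a ∈ U <;> simp [ha]
  have hone : ∑ a, w a = 1 := by
    have := hlaw Set.univ
    simpa using this.symm
  have h := fkg (Sᶜ.indicator 1) (T.indicator 1) w
    (fun a => Finset.prod_nonneg fun i _ => measureReal_nonneg)
    (fun a => Set.indicator_nonneg (by simp) a) (fun a => Set.indicator_nonneg (by simp) a)
    (fun a b hab => by
      by_cases ha : a ∈ Sᶜ
      · have hb : b ∈ Sᶜ := fun hb => ha (hS hab hb)
        simp [Set.indicator_of_mem ha, Set.indicator_of_mem hb]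
      · rw [Set.indicator_of_notMem ha]
        exact Set.indicator_nonneg (by simp) b)
    (fun a b hab => by
      by_cases ha : a ∈ T
      · have hb : b ∈ T := hT hab ha
        simp [Set.indicator_of_mem ha, Set.indicator_of_mem hb]
      · rw [Set.indicator_of_notMem ha]
        exact Set.indicator_nonneg (by simp) b)
    (fun a b => by
      -- a product weight is log-modular
      refine le_of_eq ?_
      simp only [hw]
      rw [← Finset.prod_mul_distrib, ← Finset.prod_mul_distrib]
      refine Finset.prod_congr rfl fun i _ => ?_
      simp only [Pi.inf_apply, Pi.sup_apply]
      rcases le_total (a i) (b i) with hi | hi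
      · rw [inf_eq_left.2 hi, sup_eq_right.2 hi]
      · rw [inf_eq_right.2 hi, sup_eq_left.2 hi, mul_comm])
  have hfg : ∀ a, (Sᶜ.indicator 1 a : ℝ) * T.indicator 1 a
      = T.indicator 1 a - (S ∩ T).indicator 1 a := by
    intro a
    by_cases ha : a ∈ S <;> by_cases hb : a ∈ T <;> simp [ha, hb]
  simp_rw [hfg, mul_sub, Finset.sum_sub_distrib, ← hlaw, hone, one_mul] at h
  have hc : μ.real {ω | (fun i => K i ω) ∈ Sᶜ} = 1 - μ.real {ω | (fun i => K i ω) ∈ S} := by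
    have hm : MeasurableSet {ω | (fun i => K i ω) ∈ S} := hKm (Set.toFinite S).measurableSet
    exact probReal_compl_eq_one_sub hm
  rw [hc] at h
  linarith

/-- The largest `j` such that at least `j` levels are at most `r j`. -/
def stepUp {ι : Type*} [Fintype ι] {L : ℕ} (r : ℕ → ℕ) (a : ι → Fin L) : ℕ :=
  Nat.findGreatest (fun j => j ≤ levelCount a (r j)) (Fintype.card ι)

lemma stepUp_le_iff (r : ℕ → ℕ) (a : ι → Fin L) (k : ℕ) :
    stepUp r a ≤ k ↔ ∀ j, k < j → j ≤ Fintype.card ι → levelCount a (r j) < j := by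
  constructor
  · intro h j hkj hj
    by_contra hcon
    have := Nat.le_findGreatest (P := fun j => j ≤ levelCount a (r j)) hj (not_lt.1 hcon)
    exact absurd (this.trans h) (not_le.2 hkj)
  · intro h
    by_contra hcon
    have h1 : stepUp r a ≤ levelCount a (r (stepUp r a)) :=
      Nat.findGreatest_spec (P := fun j => j ≤ levelCount a (r j)) (Nat.zero_le _) (Nat.zero_le _)
    exact absurd (h _ (not_le.1 hcon) (Nat.findGreatest_le _)) (not_lt.2 h1)

lemma stepUp_le_levelCount (r : ℕ → ℕ) (a : ι → Fin L) :
    stepUp r a ≤ levelCount a (r (stepUp r a)) :=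
  Nat.findGreatest_spec (P := fun j => j ≤ levelCount a (r j)) (Nat.zero_le _) (Nat.zero_le _)

/-- By Harris' inequality, a success at `k` is negatively correlated with the absence of later
successes. -/
lemma measureReal_stepUp_eq_le (hK : ∀ i, Measurable (K i)) (hind : iIndepFun K μ)
    (r : ℕ → ℕ) (k : ℕ) :
    μ.real {ω | stepUp r (fun i => K i ω) = k}
      ≤ μ.real {ω | k ≤ levelCount (fun i => K i ω) (r k)}
        * μ.real {ω | stepUp r (fun i => K i ω) ≤ k} := by
  have hS : IsLowerSet {a : ι → Fin L | k ≤ levelCount a (r k)} := fun a b hba ha =>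
    le_trans (α := ℕ) ha (levelCount_anti hba _)
  have hT : IsUpperSet {a : ι → Fin L | stepUp r a ≤ k} := fun a b hab ha => by
    simp only [Set.mem_ofPred_eq, stepUp_le_iff] at ha ⊢
    exact fun j hj hj' => (levelCount_anti hab _).trans_lt (ha j hj hj')
  refine le_trans (measureReal_mono ?_) (measureReal_inter_le_mul hK hind hS hT)
  rintro ω hω
  simp only [Set.mem_ofPred_eq] at hω
  refine ⟨?_, hω.le⟩
  have := stepUp_le_levelCount r (fun i => K i ω)
  rw [hω] at this
  exact this

/-- If a step-up procedure on independent levels with value `j` earns the reward `j / x j`, where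
`x j` bounds the expected number of levels at most `r j`, then the expected reward is at most
`1.93`.  The sequence `r` is arbitrary; in particular no monotonicity is needed. -/
theorem integral_stepUp_div_le (hK : ∀ i, Measurable (K i)) (hind : iIndepFun K μ)
    (r : ℕ → ℕ) (x : ℕ → ℝ) (hx : ∀ j, 1 ≤ j → 0 < x j)
    (hmean : ∀ j, 1 ≤ j → ∑ i, μ.real {ω | (K i ω : ℕ) ≤ r j} ≤ x j) :
    ∫ ω, (stepUp r (fun i => K i ω) : ℝ) / x (stepUp r fun i => K i ω) ∂μ ≤ 1.93 := by
  classical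
  set V : Ω → ℕ := fun ω => stepUp r fun i => K i ω with hV
  have hKm : Measurable fun ω => fun i => K i ω := measurable_pi_lambda _ hK
  have hVm : Measurable V := (measurable_of_finite (stepUp r)).comp hKm
  have hmE : ∀ k, MeasurableSet {ω | V ω = k} := fun k => hVm (measurableSet_singleton k)
  have hmL : ∀ k, MeasurableSet {ω | V ω ≤ k} := fun k => hVm measurableSet_Iic
  have key : ∀ k, ∑ j ∈ Finset.range (k + 1), (j : ℝ) / x j * μ.real {ω | V ω = j}
      ≤ budget k * μ.real {ω | V ω ≤ k} := by
    intro k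
    induction k with
    | zero => simp [budget]
    | succ k ih =>
      rw [Finset.sum_range_succ]
      have hx' := hx (k + 1) (by omega)
      have hsplit : μ.real {ω | V ω ≤ k + 1} = μ.real {ω | V ω ≤ k} + μ.real {ω | V ω = k + 1} := by
        rw [← measureReal_union _ (hmE _)]
        · congr 1; ext ω; simp only [Set.mem_ofPred_eq, Set.mem_union]; omega
        · rw [Set.disjoint_left]; intro ω h1 h2
          simp only [Set.mem_ofPred_eq] at h1 h2; omega
      have hb : budget (k + 1) = budget k + budgetStep k := by
        rw [budget, Finset.sum_range_succ, ← budget]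
      have hP0 : 0 ≤ μ.real {ω | V ω ≤ k + 1} := measureReal_nonneg
      have hstep : (((k + 1 : ℕ) : ℝ) / x (k + 1) - budget k) * μ.real {ω | V ω = k + 1}
          ≤ budgetStep k * μ.real {ω | V ω ≤ k + 1} := by
        rcases le_or_gt (((k + 1 : ℕ) : ℝ) / x (k + 1) - budget k) 0 with hneg | hpos
        · exact (mul_nonpos_of_nonpos_of_nonneg hneg measureReal_nonneg).trans
            (mul_nonneg (budgetStep_nonneg k) hP0)
        · have h1 := measureReal_stepUp_eq_le hK hind r (k + 1)
          have h2 : μ.real {ω | k + 1 ≤ levelCount (fun i => K i ω) (r (k + 1))}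
              ≤ poissonExcess k (x (k + 1)) :=
            (measureReal_levelCount_le hK hind _ k).trans
              (poissonExcess_mono k (Finset.sum_nonneg fun _ _ => measureReal_nonneg)
                (hmean (k + 1) (by omega)))
          calc _ ≤ (((k + 1 : ℕ) : ℝ) / x (k + 1) - budget k)
                * (poissonExcess k (x (k + 1)) * μ.real {ω | V ω ≤ k + 1}) := by
                refine mul_le_mul_of_nonneg_left (h1.trans ?_) hpos.le
                exact mul_le_mul_of_nonneg_right h2 hP0
            _ = (((k + 1 : ℕ) : ℝ) / x (k + 1) - budget k) * poissonExcess k (x (k + 1))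
                * μ.real {ω | V ω ≤ k + 1} := by ring
            _ ≤ _ := by
                gcongr
                exact mul_poissonExcess_le_budgetStep k hx'
      rw [hb]
      rw [hsplit] at hstep ⊢
      nlinarith
  set n := Fintype.card ι with hn
  have hVn : ∀ ω, V ω ≤ n := fun ω => Nat.findGreatest_le _
  have hsum : ∀ ω, (V ω : ℝ) / x (V ω) = ∑ j ∈ Finset.range (n + 1),
      {ω | V ω = j}.indicator (fun _ => (j : ℝ) / x j) ω := by
    intro ω
    rw [Finset.sum_eq_single (V ω)]
    · simp
    · intro j _ hj
      simp [hj.symm]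
    · intro h
      exact absurd (Finset.mem_range.2 (Nat.lt_succ_of_le (hVn ω))) h
  calc _ = ∫ ω, ∑ j ∈ Finset.range (n + 1),
          {ω | V ω = j}.indicator (fun _ => (j : ℝ) / x j) ω ∂μ :=
        integral_congr_ae (ae_of_all _ hsum)
    _ = ∑ j ∈ Finset.range (n + 1), ∫ ω, {ω | V ω = j}.indicator (fun _ => (j : ℝ) / x j) ω ∂μ :=
        integral_finsetSum _ fun j _ => (integrable_const _).indicator (hmE j)
    _ = ∑ j ∈ Finset.range (n + 1), (j : ℝ) / x j * μ.real {ω | V ω = j} :=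
        Finset.sum_congr rfl fun j _ => by
          rw [integral_indicator_const _ (hmE j), smul_eq_mul, mul_comm]
    _ ≤ budget n * μ.real {ω | V ω ≤ n} := key n
    _ ≤ 1.93 * 1 := by
        gcongr
        · exact budget_le n
        · exact measureReal_le_one
    _ = 1.93 := mul_one _

end Levels

/-! ### The Benjamini-Hochberg procedure on levels -/

/-- The number of grid points `α k / m`, `0 ≤ k ≤ m`, strictly below `u`.  For `k ≤ m` the level is
at most `k` if and only if `u ≤ α k / m`. -/
noncomputable def pLevel (α : ℝ) (m : ℕ) (u : ℝ) : Fin (m + 2) :=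
  ⟨((Finset.range (m + 1)).filter fun k : ℕ => α * (k : ℝ) / (m : ℝ) < u).card,
    Nat.lt_succ_of_le ((Finset.card_filter_le _ _).trans (Finset.card_range _).le)⟩

lemma pLevel_le_iff {α : ℝ} (hα : 0 ≤ α) {m k : ℕ} (hk : k ≤ m) (u : ℝ) :
    (pLevel α m u : ℕ) ≤ k ↔ u ≤ α * (k : ℝ) / (m : ℝ) := by
  have hgrid : ∀ {a b : ℕ}, a ≤ b → α * (a : ℝ) / (m : ℝ) ≤ α * (b : ℝ) / (m : ℝ) := by
    intro a b hab
    have : (a : ℝ) ≤ b := by exact_mod_cast hab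
    gcongr
  constructor
  · intro h
    by_contra hu
    have hsub : Finset.range (k + 1)
        ⊆ (Finset.range (m + 1)).filter fun k : ℕ => α * (k : ℝ) / (m : ℝ) < u := by
      intro j hj
      rw [Finset.mem_range] at hj
      rw [Finset.mem_filter, Finset.mem_range]
      exact ⟨by omega, (hgrid (by omega)).trans_lt (not_le.1 hu)⟩
    have := Finset.card_le_card hsub
    rw [Finset.card_range] at this
    exact absurd (this.trans h) (by omega)
  · intro hu
    have hsub : ((Finset.range (m + 1)).filter fun k : ℕ => α * (k : ℝ) / (m : ℝ) < u)
        ⊆ Finset.range k := by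
      intro j hj
      rw [Finset.mem_filter] at hj
      rw [Finset.mem_range]
      by_contra hjk
      exact absurd (hu.trans (hgrid (not_lt.1 hjk))) (not_le.2 hj.2)
    have := Finset.card_le_card hsub
    rwa [Finset.card_range] at this

lemma measurable_pLevel (α : ℝ) (m : ℕ) : Measurable (pLevel α m) := by
  have h : Measurable fun u : ℝ =>
      ∑ k ∈ Finset.range (m + 1), if α * (k : ℝ) / (m : ℝ) < u then 1 else 0 :=
    Finset.measurable_sum _ fun k _ =>
      Measurable.ite measurableSet_Ioi measurable_const measurable_const
  have hg : Measurable fun n : ℕ => (⟨min n (m + 1), by omega⟩ : Fin (m + 2)) :=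
    measurable_from_nat
  convert hg.comp h using 1
  ext u
  have hle : ((Finset.range (m + 1)).filter fun k : ℕ => α * (k : ℝ) / (m : ℝ) < u).card ≤ m + 1 :=
    (Finset.card_filter_le _ _).trans (Finset.card_range _).le
  simp only [Function.comp, pLevel, Finset.sum_boole, Nat.cast_id]
  rw [min_eq_left hle]

/-- The Benjamini-Hochberg rejection set in terms of the levels. -/
def levelRejections {m : ℕ} (c : Fin m → Fin (m + 2)) : Finset (Fin m) :=
  Finset.univ.filter fun i => (c i : ℕ) ≤ Nat.findGreatest (fun k => k ≤ levelCount c k) m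

lemma bhNumRejections_eq {m : ℕ} {α : ℝ} (hα : 0 ≤ α) (p : Fin m → ℝ) :
    bhNumRejections α p
      = Nat.findGreatest (fun k => k ≤ levelCount (fun i => pLevel α m (p i)) k) m := by
  have hcount : ∀ k ≤ m, (Finset.univ.filter fun i : Fin m => p i ≤ α * (k : ℝ) / (m : ℝ)).card
      = levelCount (fun i => pLevel α m (p i)) k := by
    intro k hk
    simp only [levelCount, pLevel_le_iff hα hk]
  set R := Nat.findGreatest (fun k => k ≤ levelCount (fun i => pLevel α m (p i)) k) m with hR
  have hRm : R ≤ m := Nat.findGreatest_le _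
  refine le_antisymm (Finset.sup_le fun k hk => ?_) ?_
  · rw [Finset.mem_filter, Finset.mem_Icc] at hk
    rw [hcount k hk.1.2] at hk
    exact Nat.le_findGreatest hk.1.2 hk.2
  · rcases Nat.eq_zero_or_pos R with h0 | hpos
    · rw [h0]; exact Nat.zero_le _
    · refine Finset.le_sup (f := id) (?_ : R ∈ _)
      rw [Finset.mem_filter, Finset.mem_Icc, hcount R hRm]
      exact ⟨⟨hpos, hRm⟩, Nat.findGreatest_spec
        (P := fun k => k ≤ levelCount (fun i => pLevel α m (p i)) k) (Nat.zero_le m) (Nat.zero_le _)⟩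

lemma bhRejections_eq {m : ℕ} {α : ℝ} (hα : 0 ≤ α) (p : Fin m → ℝ) :
    bhRejections α p = levelRejections fun i => pLevel α m (p i) := by
  rw [bhRejections, bhNumRejections_eq hα, levelRejections]
  refine Finset.filter_congr fun i _ => ?_
  rw [pLevel_le_iff hα (Nat.findGreatest_le _)]

/-- Any function of the Benjamini-Hochberg rejection set is integrable, as it takes finitely many
values. -/
lemma integrable_bhRejections {Ω : Type*} [MeasurableSpace Ω] {μ : Measure Ω}
    [IsProbabilityMeasure μ] {m : ℕ} {α : ℝ} (hα : 0 ≤ α) {p : Fin m → Ω → ℝ}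
    (hp : ∀ i, Measurable (p i)) (F : Finset (Fin m) → ℝ) :
    Integrable (fun ω => F (bhRejections α fun i => p i ω)) μ := by
  have hm : Measurable fun ω => fun i => pLevel α m (p i ω) :=
    measurable_pi_lambda _ fun i => (measurable_pLevel α m).comp (hp i)
  have : IsProbabilityMeasure (μ.map fun ω => fun i => pLevel α m (p i ω)) :=
    Measure.isProbabilityMeasure_map hm.aemeasurable
  have h := (Integrable.of_finite (μ := μ.map fun ω => fun i => pLevel α m (p i ω))
    (f := fun c => F (levelRejections c))).comp_measurable hm
  simp only [bhRejections_eq hα]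
  exact h

/-- For a step-up procedure based on the sum of two counts, the threshold `R` and the contribution
`N₀ R` of the first count can be computed from the first count along the thresholds `r j` that the
second count alone determines. -/
lemma findGreatest_add_eq {N₀ N₁ : ℕ → ℕ} {m n : ℕ} (h₀ : Monotone N₀) (h₁ : Monotone N₁)
    (hm : ∀ k, N₀ k + N₁ k ≤ m) (hn : ∀ k, N₀ k ≤ n) {R V : ℕ} {r : ℕ → ℕ}
    (hR : R = Nat.findGreatest (fun k => k ≤ N₀ k + N₁ k) m)
    (hr : ∀ j, r j = Nat.findGreatest (fun k => k ≤ j + N₁ k) m)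
    (hV : V = Nat.findGreatest (fun j => j ≤ N₀ (r j)) n) :
    N₀ R + N₁ R = R ∧ V = N₀ R ∧ r V = R := by
  have hRspec : R ≤ N₀ R + N₁ R := by
    rw [hR]
    exact Nat.findGreatest_spec (P := fun k => k ≤ N₀ k + N₁ k) (Nat.zero_le m) (Nat.zero_le _)
  have hRmax : ∀ k ≤ m, k ≤ N₀ k + N₁ k → k ≤ R := fun k hk hk' => by
    rw [hR]; exact Nat.le_findGreatest hk hk'
  have hrm : ∀ j, r j ≤ m := fun j => by rw [hr]; exact Nat.findGreatest_le _
  have hrspec : ∀ j, r j ≤ j + N₁ (r j) := fun j => by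
    rw [hr]
    exact Nat.findGreatest_spec (P := fun k => k ≤ j + N₁ k) (Nat.zero_le m) (Nat.zero_le _)
  have hVspec : V ≤ N₀ (r V) := by
    rw [hV]
    exact Nat.findGreatest_spec (P := fun j => j ≤ N₀ (r j)) (Nat.zero_le n) (Nat.zero_le _)
  have hRm : R ≤ m := hRspec.trans (hm R)
  have hfix : N₀ R + N₁ R = R := le_antisymm
    (hRmax _ (hm R) (Nat.add_le_add (h₀ hRspec) (h₁ hRspec))) hRspec
  have hrR : ∀ j, j ≤ N₀ (r j) → r j ≤ R := fun j hj =>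
    hRmax _ (hrm j) ((hrspec j).trans (Nat.add_le_add_right hj _))
  have hge : R ≤ r (N₀ R) := by
    rw [hr]; exact Nat.le_findGreatest hRm hfix.ge
  have heq : r (N₀ R) = R := le_antisymm (hrR _ (h₀ hge)) hge
  have hVR : V = N₀ R := by
    refine le_antisymm (hVspec.trans (h₀ (hrR V hVspec))) ?_
    rw [hV]
    exact Nat.le_findGreatest (hn R) (h₀ hge)
  exact ⟨hfix, hVR, by rw [hVR, heq]⟩

lemma levelCount_add_levelCount {m L : ℕ} (H₀ : Finset (Fin m)) (c : Fin m → Fin L) (k : ℕ) :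
    levelCount (fun i : {i // i ∈ H₀} => c i) k + levelCount (fun i : {i // i ∉ H₀} => c i) k
      = levelCount c k := by
  simp only [levelCount, Finset.card_filter]
  convert Fintype.sum_subtype_add_sum_subtype (· ∈ H₀) fun i => if (c i : ℕ) ≤ k then 1 else 0

/-- The threshold, in terms of the number `j` of false discoveries, that is determined by the levels
`b` of the non-nulls. -/
def nonnullThreshold {ι : Type*} [Fintype ι] {L : ℕ} (m : ℕ) (b : ι → Fin L) (j : ℕ) : ℕ :=
  Nat.findGreatest (fun k => k ≤ j + levelCount b k) m

lemma one_le_nonnullThreshold {ι : Type*} [Fintype ι] {L m : ℕ} (hm : 1 ≤ m) (b : ι → Fin L)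
    {j : ℕ} (hj : 1 ≤ j) : 1 ≤ nonnullThreshold m b j :=
  Nat.le_findGreatest hm (hj.trans (Nat.le_add_right _ _))

/-- The numbers of false discoveries and of discoveries, expressed through a step-up procedure on
the null levels whose thresholds depend on the non-null levels only. -/
lemma card_levelRejections {m : ℕ} (H₀ : Finset (Fin m)) (c : Fin m → Fin (m + 2)) :
    (levelRejections c ∩ H₀).card
        = stepUp (nonnullThreshold m fun i : {i // i ∉ H₀} => c i) (fun i : {i // i ∈ H₀} => c i) ∧
      (levelRejections c).card
        = nonnullThreshold m (fun i : {i // i ∉ H₀} => c i)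
          (stepUp (nonnullThreshold m fun i : {i // i ∉ H₀} => c i)
            fun i : {i // i ∈ H₀} => c i) := by
  have hadd := levelCount_add_levelCount H₀ c
  have hle : ∀ k, levelCount c k ≤ m := fun k =>
    (Finset.card_le_univ _).trans (Fintype.card_fin m).le
  obtain ⟨h1, h2, h3⟩ := findGreatest_add_eq
    (N₀ := levelCount fun i : {i // i ∈ H₀} => c i) (N₁ := levelCount fun i : {i // i ∉ H₀} => c i)
    (m := m) (n := Fintype.card {i // i ∈ H₀}) (levelCount_mono _) (levelCount_mono _)
    (fun k => by rw [hadd]; exact hle k) (fun k => Finset.card_le_univ _) rfl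
    (r := nonnullThreshold m fun i : {i // i ∉ H₀} => c i) (fun j => rfl)
    (V := stepUp (nonnullThreshold m fun i : {i // i ∉ H₀} => c i) fun i : {i // i ∈ H₀} => c i) rfl
  simp only [hadd] at h1 h2 h3
  refine ⟨?_, ?_⟩
  · rw [h2, levelRejections, levelCount, Finset.inter_comm, ← Finset.filter_mem_eq_inter,
      Finset.card_filter, Finset.card_filter]
    simp only [Finset.mem_filter, Finset.mem_univ, true_and]
    exact (Finset.sum_coe_sort H₀ fun i => if (c i : ℕ)
      ≤ Nat.findGreatest (fun k => k ≤ levelCount c k) m then 1 else 0).symm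
  · rw [h3]; exact h1

/-- An expectation with respect to two independent finite-valued variables is bounded if it is
bounded for every fixed value of the second one. -/
lemma integral_le_of_indepFun {Ω A B : Type*} [MeasurableSpace Ω] {μ : Measure Ω}
    [IsProbabilityMeasure μ] [Finite A] [MeasurableSpace A] [MeasurableSingletonClass A] [Finite B]
    [MeasurableSpace B] [MeasurableSingletonClass B] {X : Ω → A} {Y : Ω → B} (hX : Measurable X)
    (hY : Measurable Y) (hXY : IndepFun X Y μ) (f : A → B → ℝ) {C : ℝ}
    (hC : ∀ b, ∫ ω, f (X ω) b ∂μ ≤ C) : ∫ ω, f (X ω) (Y ω) ∂μ ≤ C := by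
  have : IsProbabilityMeasure (μ.map X) := Measure.isProbabilityMeasure_map hX.aemeasurable
  have : IsProbabilityMeasure (μ.map Y) := Measure.isProbabilityMeasure_map hY.aemeasurable
  have hmap := (indepFun_iff_map_prod_eq_prod_map_map hX.aemeasurable hY.aemeasurable).1 hXY
  have hf : Measurable (Function.uncurry f) := measurable_of_finite _
  calc ∫ ω, f (X ω) (Y ω) ∂μ = ∫ z, Function.uncurry f z ∂(μ.map fun ω => (X ω, Y ω)) :=
        (integral_map (hX.prodMk hY).aemeasurable hf.aestronglyMeasurable).symm
    _ = ∫ b, ∫ a, f a b ∂(μ.map X) ∂(μ.map Y) := by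
        rw [hmap, integral_prod_symm _ Integrable.of_finite]; rfl
    _ ≤ ∫ _, C ∂(μ.map Y) := by
        refine integral_mono Integrable.of_finite Integrable.of_finite fun b => ?_
        have hb : Measurable fun a => f a b := measurable_of_finite _
        show ∫ a, f a b ∂(μ.map X) ≤ C
        rw [integral_map hX.aemeasurable hb.aestronglyMeasurable]
        exact hC b
    _ = C := by simp

/-- The common form of both claims: `κ` is the additional constant in the denominator. -/
lemma integral_card_inter_div_le {Ω : Type*} [MeasurableSpace Ω] {μ : Measure Ω}
    [IsProbabilityMeasure μ] {α A κ : ℝ} (hα : 0 ≤ α) (hA : 0 < A) (hκ : 0 ≤ κ) {m : ℕ}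
    (hm : 1 ≤ m) {H₀ : Finset (Fin m)} {p : Fin m → Ω → ℝ} (hp : ∀ i, Measurable (p i))
    (hindep : NullIndep μ H₀ p)
    (hmean : ∀ k : ℕ, k ≤ m →
      ∑ i ∈ H₀, μ.real {ω | p i ω ≤ α * (k : ℝ) / (m : ℝ)} ≤ A * (k + κ)) :
    ∫ ω, ((bhRejections α fun i => p i ω) ∩ H₀).card
      / (κ + (bhRejections α fun i => p i ω).card) ∂μ ≤ 1.93 * A := by
  set X : Ω → {i // i ∈ H₀} → Fin (m + 2) := fun ω i => pLevel α m (p i ω) with hXdef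
  set Y : Ω → {i // i ∉ H₀} → Fin (m + 2) := fun ω i => pLevel α m (p i ω) with hYdef
  have hlev := measurable_pLevel α m
  have hX : Measurable X := measurable_pi_lambda _ fun i => hlev.comp (hp i)
  have hY : Measurable Y := measurable_pi_lambda _ fun i => hlev.comp (hp i)
  have hXY : IndepFun X Y μ := hindep.2.comp
    (φ := fun (u : {i // i ∈ H₀} → ℝ) i => pLevel α m (u i))
    (ψ := fun (u : {i // i ∉ H₀} → ℝ) i => pLevel α m (u i))
    (measurable_pi_lambda _ fun i => hlev.comp (measurable_pi_apply i))
    (measurable_pi_lambda _ fun i => hlev.comp (measurable_pi_apply i))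
  have hind : iIndepFun (fun (i : {i // i ∈ H₀}) ω => X ω i) μ :=
    hindep.1.comp (fun _ => pLevel α m) fun _ => hlev
  set f : ({i // i ∈ H₀} → Fin (m + 2)) → ({i // i ∉ H₀} → Fin (m + 2)) → ℝ := fun a b =>
    A * ((stepUp (nonnullThreshold m b) a : ℝ)
      / (A * (nonnullThreshold m b (stepUp (nonnullThreshold m b) a) + κ))) with hf
  have hcard : ∀ ω, (((bhRejections α fun i => p i ω) ∩ H₀).card : ℝ)
      / (κ + (bhRejections α fun i => p i ω).card) = f (X ω) (Y ω) := by
    intro ω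
    obtain ⟨h1, h2⟩ := card_levelRejections H₀ fun i => pLevel α m (p i ω)
    rw [bhRejections_eq hα, h1, h2]
    simp only [hf, hXdef, hYdef]
    rw [mul_div_assoc', mul_div_mul_left _ _ hA.ne', add_comm κ]
  simp_rw [hcard]
  refine integral_le_of_indepFun hX hY hXY f fun b => ?_
  simp only [hf]
  rw [integral_const_mul, mul_comm]
  refine mul_le_mul_of_nonneg_right ?_ hA.le
  refine integral_stepUp_div_le (K := fun i ω => X ω i) (fun i => hlev.comp (hp i)) hind
    (nonnullThreshold m b) (fun j => A * (nonnullThreshold m b j + κ)) (fun j hj => ?_)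
    fun j hj => ?_
  · have : (1 : ℝ) ≤ nonnullThreshold m b j := by
      exact_mod_cast one_le_nonnullThreshold hm b hj
    positivity
  · have hr : nonnullThreshold m b j ≤ m := Nat.findGreatest_le _
    refine le_trans (le_of_eq ?_) (hmean _ hr)
    simp only [hXdef, pLevel_le_iff hα hr]
    exact Finset.sum_coe_sort H₀ fun i =>
      μ.real {ω | p i ω ≤ α * (nonnullThreshold m b j : ℝ) / (m : ℝ)}

/-! ### The false discovery rate bounds -/

theorem theorem3 {Ω : Type*} [MeasurableSpace Ω] (μ : Measure Ω) [IsProbabilityMeasure μ]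
    (α : ℝ) (hα : α ∈ Set.Icc (0 : ℝ) 1) (m : ℕ) (hm : 1 ≤ m) (H₀ : Finset (Fin m))
    (ε δ : ℝ) (hε : 0 ≤ ε) (hδ : 0 ≤ δ)
    (p : Fin m → Ω → ℝ) (hmeas : ∀ i, Measurable (p i))
    (hp : ∀ i ω, p i ω ∈ Set.Icc (0 : ℝ) 1)
    (hindep : NullIndep μ H₀ p)
    (hcompound : IsApproxCompoundPValues μ H₀ ε δ p) :
    (δ = 0 →
      Integrable (fun ω => FDP H₀ (bhRejections α fun i => p i ω)) μ ∧
      bhFDR μ H₀ α p ≤ 1.93 * α * (1 + ε)) ∧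
    (0 < δ →
      Integrable (fun ω => modifiedFDP ε δ α H₀ (bhRejections α fun i => p i ω)) μ ∧
      ∫ ω, modifiedFDP ε δ α H₀ (bhRejections α fun i => p i ω) ∂μ ≤ 1.93 * α * (1 + ε)) := by
  have hm0 : (0 : ℝ) < m := by exact_mod_cast hm
  refine ⟨fun h0 => ⟨integrable_bhRejections hα.1 hmeas _, ?_⟩,
    fun hpos => ⟨integrable_bhRejections hα.1 hmeas _, ?_⟩⟩ <;>
    rcases hα.1.eq_or_lt with hα0 | hα0
  · -- for `α = 0` only p-values equal to `0` are rejected, and almost surely no null is among them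
    subst hα0 h0
    have hzero : ∀ i ∈ H₀, ∀ᵐ ω ∂μ, ¬ p i ω ≤ 0 := by
      intro i hi
      have h1 := hcompound 0 (by simp)
      simp only [zero_mul, add_zero, mul_zero] at h1
      have h2 : μ.real {ω | p i ω ≤ 0} = 0 := le_antisymm
        ((Finset.single_le_sum (f := fun i => μ.real {ω | p i ω ≤ 0})
          (fun _ _ => measureReal_nonneg) hi).trans h1) measureReal_nonneg
      rw [measureReal_eq_zero_iff] at h2
      rw [ae_iff]
      simpa using h2
    have hae : ∀ᵐ ω ∂μ, FDP H₀ (bhRejections 0 fun i => p i ω) = 0 := by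
      filter_upwards [(Filter.eventually_all_finset H₀).2 hzero] with ω hω
      have : (bhRejections 0 fun i => p i ω) ∩ H₀ = ∅ := by
        refine Finset.eq_empty_of_forall_notMem fun i hi => ?_
        rw [Finset.mem_inter, bhRejections, Finset.mem_filter] at hi
        exact hω i hi.2 (by simpa using hi.1.2)
      simp [FDP, this]
    rw [bhFDR, integral_congr_ae hae]
    simp
  · subst h0
    have hA : 0 < α * (1 + ε) := by positivity
    have h := integral_card_inter_div_le hα.1 hA le_rfl hm hmeas hindep fun k hk => by
      refine (hcompound (α * k / m) ⟨by positivity, ?_⟩).trans (le_of_eq (by field_simp; ring))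
      have : (k : ℝ) ≤ m := by exact_mod_cast hk
      rw [div_le_one hm0]
      nlinarith [hα.2]
    rw [← mul_assoc] at h
    refine le_trans (le_of_eq (integral_congr_ae (ae_of_all _ fun ω => ?_))) h
    -- the maximum with `1` only matters for an empty rejection set, where both ratios vanish
    simp only [FDP, zero_add]
    rcases Nat.eq_zero_or_pos (bhRejections α fun i => p i ω).card with hc | hc
    · rw [Finset.card_eq_zero] at hc; simp [hc]
    · rw [max_eq_right (by exact_mod_cast hc)]
  · simp [modifiedFDP, ← hα0]
  · have hA : 0 < α * (1 + ε) := by positivity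
    have h := integral_card_inter_div_le (κ := m * δ / (α * (1 + ε))) hα.1 hA (by positivity) hm
      hmeas hindep fun k hk => by
        refine (hcompound (α * k / m) ⟨by positivity, ?_⟩).trans (le_of_eq (by field_simp))
        have : (k : ℝ) ≤ m := by exact_mod_cast hk
        rw [div_le_one hm0]
        nlinarith [hα.2]
    rw [← mul_assoc] at h
    simpa only [modifiedFDP, if_neg hα0.ne'] using h
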